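/- Let $\mathcal M$ and $\mathcal X$ be finite sets, let $\widehat{\mathcal M}$ be a second countable Hausdorff space with its Borel $\sigma$-algebra (for instance a finite set), let $\mathsf d\colon \mathcal M\times\widehat{\mathcal M}\to[0,+\infty]$ be measurable in its second argument, let $P_{SX}$ be a probability distribution on $\mathcal M\times\mathcal X$, and let $d\in\mathbb R$. Logarithms are to a fixed base greater than $1$. For a nonzero vector $P_{\bar S\bar X}$ of nonnegative masses on $\mathcal M\times\mathcal X$, not necessarily of total mass one, put $P_{\bar X}(x)=\sum_s P_{\bar S\bar X}(s,x)$ and $P_{\bar S|\bar X}(s|x)=P_{\bar S\bar X}(s,x)/P_{\bar X}(x)$. For a transition kernel $P_{Z|X}$ from $\mathcal X$ to $\widehat{\mathcal M}$ put $P_{\bar Z}=\sum_x P_{\bar X}(x)P_{Z|X=x}$, $I(\bar X;\bar Z)=\sum_x P_{\bar X}(x)\,D(P_{Z|X=x}\|P_{\bar Z})$, where $D(\mu\|\nu)=\int\log\frac{d\mu}{d\nu}\,d\mu$, and $\bar{\mathsf d}(x,z)=\sum_s P_{\bar S|\bar X}(s|x)\,\mathsf d(s,z)$. Define $$\mathbb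 R_{\bar S,\bar X}(d)=\inf\Big\{ I(\bar X;\bar Z)\ :\ \textstyle\sum_x P_{\bar X}(x)\int \bar{\mathsf d}(x,z)\,dP_{Z|X=x}(z)\ \le\ d\,\sum_{s,x}P_{\bar S\bar X}(s,x)\Big\}.$$ For probability vectors this is the usual noisy rate-distortion function. Whenever the infimum is achieved, let $P_{\bar Z^\star|\bar X}$ be a kernel achieving it (any choice), let $\bar\lambda^\star=-\mathbb R'_{\bar S,\bar X}(d)$ (derivative in $d$), and define the noisy $\mathsf d$-tilted information $$\tilde\jmath_{\bar S,\bar X}(s,x,d)=D(P_{\bar Z^\star|\bar X=x}\|P_{\bar Z^\star})+\bar\lambda^\star\int\mathsf d(s,z)\,dP_{\bar Z^\star|\bar X=x}(z)-\bar\lambda^\star d .$$ Assume that $d>d_{\min}=\inf\{\delta:\mathbb R_{S,X}(\delta)<\infty\}$, that the infimum defining $\mathbb R_{S,X}(d)$ is achieved with equality in the distortion constraint, and that for all probability distributions $P_{\bar S\bar X}$ in some Euclidean neighborhood of $P_{SX}$ the infimum defining $\mathbb R_{\bar S,\bar X}(d)$ is achieved, $\mathbb R_{\bar S,\bar X}(\cdot)$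 is differentiable at $d$, and $\mathrm{supp}(P_{\bar Z^\star})=\mathrm{supp}(P_{Z^\star})$ for every optimal $P_{\bar Z^\star|\bar X}$. Then, for every $(s,x)$ with $P_{SX}(s,x)>0$, the following partial derivatives, in which the mass $P_{\bar S\bar X}(s,x)$ is varied and all other masses are kept fixed, exist and satisfy $$\frac{\partial}{\partial P_{\bar S\bar X}(s,x)}\,\mathbb E\big[\tilde\jmath_{\bar S,\bar X}(S,X,d)\big]\Big|_{P_{\bar S\bar X}=P_{SX}}=-\log e,$$ $$\dot{\mathbb R}_{S,X}(s,x,d):=\frac{\partial}{\partial P_{\bar S\bar X}(s,x)}\,\mathbb R_{\bar S,\bar X}(d)\Big|_{P_{\bar S\bar X}=P_{SX}}=\tilde\jmath_{S,X}(s,x,d)-\log e,$$ where the expectation is with respect to $(S,X)\sim P_{SX}$. Consequently, $$\mathrm{Var}\big[\dot{\mathbb R}_{S,X}(S,X,d)\big]=\mathrm{Var}\big[\tilde\jmath_{S,X}(S,X,d)\big].$$ -/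

import Mathlib

open MeasureTheory
open scoped Topology ENNReal

noncomputable section

namespace NoisyRD

variable {S X Z : Type*} [Fintype S] [Fintype X] [MeasurableSpace Z]

/-- A transition kernel from the finite observation alphabet `X` to the reproduction alphabet
`Z`: one probability distribution on `Z` for each letter. -/
abbrev RepKernel (X Z : Type*) [MeasurableSpace Z] := X → ProbabilityMeasure Z

/-! A joint law of `(S, X)` is given by its vector of masses `P : S × X → ℝ`. To speak of partial
derivatives with respect to a single mass, all quantities below are written for an arbitrary
nonnegative vector `P`, as sums against `P` without normalization; for probability vectors they
are the usual quantities. -/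

/-- The expectation `E[f(S, X)]` under `P`. -/
def expect (P : S × X → ℝ) (f : S × X → ℝ) : ℝ := ∑ y, P y * f y

/-- The variance `Var[f(S, X)]` under `P`. -/
def variance (P : S × X → ℝ) (f : S × X → ℝ) : ℝ :=
  expect P fun y => (f y - expect P f) ^ 2

/-- The total mass of `P` (equal to `1` for a probability vector). -/
def mass (P : S × X → ℝ) : ℝ := ∑ y, P y

/-- The marginal `P_X`. -/
def marginal (P : S × X → ℝ) (x : X) : ℝ := ∑ s, P (s, x)

/-- The conditional law `P_{S|X}(s|x)` (relevant only when `P_X(x) > 0`). -/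
def cond (P : S × X → ℝ) (s : S) (x : X) : ℝ := P (s, x) / marginal P x

/-- The output measure `P_Z = ∑ₓ P_X(x) P_{Z|X=x}`. -/
def output (P : S × X → ℝ) (W : RepKernel X Z) : Measure Z :=
  ∑ x, ENNReal.ofReal (marginal P x) • (W x : Measure Z)

/-- Relative entropy `D(μ‖ν) = ∫ log (dμ/dν) dμ`, logarithm to base `b`. It is only used for
`μ = P_{Z|X=x}` and `ν = P_Z`; when `P_X(x) > 0`, then `μ ≪ ν` with density at most `1 / P_X(x)`
and the integral converges. -/
def relEntropy (b : ℝ) (μ ν : Measure Z) : ℝ := (∫ z, llr μ ν z ∂μ) / Real.log b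

/-- Mutual information `I(X;Z) = ∑ₓ P_X(x) D(P_{Z|X=x}‖P_Z)`. -/
def mutualInfo (b : ℝ) (P : S × X → ℝ) (W : RepKernel X Z) : ℝ :=
  ∑ x, marginal P x * relEntropy b (W x : Measure Z) (output P W)

/-- The surrogate distortion measure `E[dist(S, z) | X = x]`. -/
def surrogate (dist : S → Z → ℝ≥0∞) (P : S × X → ℝ) (x : X) (z : Z) : ℝ≥0∞ :=
  ∑ s, ENNReal.ofReal (cond P s x) * dist s z

/-- The expected surrogate distortion of the pair `(X, Z)`. -/
def expDistortion (dist : S → Z → ℝ≥0∞) (P : S × X → ℝ) (W : RepKernel X Z) : ℝ≥0∞ :=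
  ∑ x, ENNReal.ofReal (marginal P x) * ∫⁻ z, surrogate dist P x z ∂(W x : Measure Z)

/-- The constraint that the expected distortion is at most `d`. The factor `mass P` is `1` for
probability vectors; in general the condition is that the distortion averaged under the
normalized `P` is at most `d`. -/
def Feasible (dist : S → Z → ℝ≥0∞) (P : S × X → ℝ) (d : ℝ) (W : RepKernel X Z) : Prop :=
  expDistortion dist P W ≠ ∞ ∧ (expDistortion dist P W).toReal ≤ d * mass P

/-- The noisy rate-distortion function: the infimum of `I(X;Z)` over the feasible kernels. -/
def rate (b : ℝ) (dist : S → Z → ℝ≥0∞) (P : S × X → ℝ) (d : ℝ) : ℝ :=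
  sInf {r | ∃ W : RepKernel X Z, Feasible dist P d W ∧ r = mutualInfo b P W}

/-- The kernel `W` achieves the infimum in the definition of the rate-distortion function. -/
def IsOptimal (b : ℝ) (dist : S → Z → ℝ≥0∞) (P : S × X → ℝ) (d : ℝ) (W : RepKernel X Z) : Prop :=
  Feasible dist P d W ∧ mutualInfo b P W = rate b dist P d

/-- `λ* = -R'(d)`. -/
def slope (b : ℝ) (dist : S → Z → ℝ≥0∞) (P : S × X → ℝ) (d : ℝ) : ℝ :=
  - deriv (fun δ => rate b dist P δ) d

/-- `E[dist(s, Z) | X = x]`, where `Z` has law `W x` given `X = x`. -/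
def condDistortion (dist : S → Z → ℝ≥0∞) (W : RepKernel X Z) (s : S) (x : X) : ℝ≥0∞ :=
  ∫⁻ z, dist s z ∂(W x : Measure Z)

/-- The noisy tilted information at `(s, x)`, built from an optimal kernel `W`. (For an optimal
`W` all terms are finite at every `(s, x)` with `P (s, x) > 0`.) -/
def tiltedInfo (b : ℝ) (dist : S → Z → ℝ≥0∞) (P : S × X → ℝ) (d : ℝ) (W : RepKernel X Z)
    (y : S × X) : ℝ :=
  relEntropy b (W y.2 : Measure Z) (output P W)
    + slope b dist P d * (condDistortion dist W y.1 y.2).toReal - slope b dist P d * d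

/-- The partial derivative of the noisy rate-distortion function with respect to the mass that
`P` puts on `y`. -/
def partialRate [DecidableEq S] [DecidableEq X] (b : ℝ) (dist : S → Z → ℝ≥0∞)
    (P : S × X → ℝ) (d : ℝ) (y : S × X) : ℝ :=
  deriv (fun u => rate b dist (Function.update P y u) d) (P y)

end NoisyRD

end

/-! The argument is an envelope theorem. Write `Q` for `P` with the mass at `y` changed to `u`. By
convexity of the rate in the distortion level, any kernel `W` of finite mean distortion gives the
Lagrangian bound `rate Q d ≤ I(Q, W) + slope Q * (mean distortion - d)` (`rate_le_lagrangian`).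
Mutual information is bounded by the mean divergence to any other output measure, up to a difference
of total masses (`mutualInfo_le_sum_relEntropy`), and that mean is linear in the input masses.
Testing `Q` with the kernel optimal at `P`, and `P` with the kernel optimal at `Q`, therefore
encloses `rate Q d - rate P d` between two multiples of `u - P y`. If optimal kernels and slopes
converge as `u → P y`, both factors tend to the tilted information minus `1 / log b`; the last term
comes from the total mass not being kept equal to one.

Slopes converge because they are subgradients of convex functions converging pointwise to a function
differentiable at `d` (`tendsto_of_hasDerivAt_of_tangent`). For the kernels, constancy of the output
support is decisive. An optimal kernel may be multiplied by a function of `z` alone; mutual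
information and distortion are linear in this factor. A direction that increases neither can be
followed until some cell loses all its mass, which the support condition forbids
(`exists_isOptimal_output_eq_zero`). A linear dependence supplies such a direction when the support
is infinite, so the support is finite (`IsOptimal.finite_support`). Two distinct optimal kernels
have proportional columns, by equality in the log-sum inequality at their midpoint, and this
supplies another such direction (`IsOptimal.unique`). Finite support gives compactness, and
uniqueness identifies every limit point (`TendstoComparably.kernel`).

For the derivative of the mean tilted information, complementary slackness gives mean `rate Q d`
under `Q`. Under `P` the mean is thus `rate Q d - (u - P y) * t u`, with `t u` the tilted
information at `y`. Its derivative is that of the rate minus the tilted information, that is, `-1 /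
log b`. The variances agree because the two random variables differ by a constant. -/

noncomputable section

namespace NoisyRD

variable {S X Z : Type*} [Fintype S] [Fintype X] [MeasurableSpace Z]
set_option linter.unusedSectionVars false

/-! ### The finite-dimensional information density -/

/-- The value at `z` of the density of the output measure, for input densities `v`. -/
def mix (q v : X → ℝ) : ℝ := ∑ x, q x * v x

/-- The integrand of mutual information (in nats), for input densities `v`. -/
def infoDensity (q v : X → ℝ) : ℝ := ∑ x, q x * (v x * Real.log (v x / mix q v))

lemma mix_nonneg {q v : X → ℝ} (hq : 0 ≤ q) (hv : 0 ≤ v) : 0 ≤ mix q v :=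
  Finset.sum_nonneg fun x _ => mul_nonneg (hq x) (hv x)

lemma mul_le_mix {q v : X → ℝ} (hq : 0 ≤ q) (hv : 0 ≤ v) (x : X) : q x * v x ≤ mix q v :=
  Finset.single_le_sum (f := fun x => q x * v x)
    (fun x _ => mul_nonneg (hq x) (hv x)) (Finset.mem_univ x)

lemma eq_zero_of_mix_eq_zero {q v : X → ℝ} (hq : 0 ≤ q) (hv : 0 ≤ v) {x : X} (hx : 0 < q x)
    (h : mix q v = 0) : v x = 0 := by
  have h1 := mul_le_mix hq hv x
  rw [h] at h1
  have h2 : 0 ≤ v x := hv x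
  nlinarith

lemma mix_smul (q v : X → ℝ) (c : ℝ) : mix q (c • v) = c * mix q v := by
  simp [mix, Finset.mul_sum, mul_left_comm]

lemma mix_add (q v w : X → ℝ) : mix q (v + w) = mix q v + mix q w := by
  simp [mix, mul_add, Finset.sum_add_distrib]

lemma infoDensity_smul (q v : X → ℝ) {c : ℝ} (hc : 0 ≤ c) :
    infoDensity q (c • v) = c * infoDensity q v := by
  rcases hc.eq_or_lt with rfl | hc
  · simp [infoDensity]
  · simp only [infoDensity, mix_smul, Finset.mul_sum, Pi.smul_apply, smul_eq_mul,
      mul_div_mul_left _ _ hc.ne']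
    exact Finset.sum_congr rfl fun x _ => by ring

/-- The tangent-plane bound for the perspective of `t ↦ t * log t`. -/
lemma tangent_le_mul_log_div {a t r : ℝ} (ha : 0 ≤ a) (ht : 0 ≤ t) (h : t = 0 → a = 0)
    (hr : 0 < r) : a * Real.log r + a - r * t ≤ a * Real.log (a / t) := by
  rcases ha.eq_or_lt with rfl | ha
  · simp; positivity
  have ht : 0 < t := lt_of_le_of_ne ht fun h' => ha.ne' (h h'.symm)
  have h1 := Real.log_le_sub_one_of_pos (show 0 < r * t / a by positivity)
  rw [Real.log_div (by positivity) ha.ne', Real.log_mul hr.ne' ht.ne'] at h1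
  rw [Real.log_div ha.ne' ht.ne']
  have h2 : a * (r * t / a - 1) = r * t - a := by field_simp
  nlinarith [mul_le_mul_of_nonneg_left h1 ha.le]

/-- For `a > 0` the bound comes from `log s ≤ s - 1` at `s = r * t / a`, which is strict unless `s =
1`. -/
lemma eq_mul_of_mul_log_div_le {a t r : ℝ} (ha : 0 ≤ a) (ht : 0 ≤ t) (h : t = 0 → a = 0)
    (hr : 0 < r) (hle : a * Real.log (a / t) ≤ a * Real.log r + a - r * t) : a = r * t := by
  rcases ha.eq_or_lt with rfl | ha
  · simp at hle; nlinarith [mul_nonneg hr.le ht]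
  have ht : 0 < t := lt_of_le_of_ne ht fun h' => ha.ne' (h h'.symm)
  by_contra hne
  have h1 := Real.log_lt_sub_one_of_pos (show 0 < r * t / a by positivity)
    (fun h' => hne (by field_simp at h'; linarith))
  rw [Real.log_div (by positivity) ha.ne', Real.log_mul hr.ne' ht.ne'] at h1
  rw [Real.log_div ha.ne' ht.ne'] at hle
  have h2 : a * (r * t / a - 1) = r * t - a := by field_simp
  nlinarith [mul_lt_mul_of_pos_left h1 ha]

lemma sub_le_mul_log_div {a t : ℝ} (ha : 0 ≤ a) (ht : 0 ≤ t) (h : t = 0 → a = 0) :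
    a - t ≤ a * Real.log (a / t) := by
  simpa using tangent_le_mul_log_div ha ht h one_pos

/-- The log-sum inequality for two terms. -/
lemma log_sum_le {a₁ a₂ t₁ t₂ : ℝ} (ha₁ : 0 ≤ a₁) (ha₂ : 0 ≤ a₂) (ht₁ : 0 ≤ t₁) (ht₂ : 0 ≤ t₂)
    (h₁ : t₁ = 0 → a₁ = 0) (h₂ : t₂ = 0 → a₂ = 0) :
    (a₁ + a₂) * Real.log ((a₁ + a₂) / (t₁ + t₂)) ≤
      a₁ * Real.log (a₁ / t₁) + a₂ * Real.log (a₂ / t₂) := by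
  rcases (add_nonneg ha₁ ha₂).eq_or_lt with h | h
  · have e₁ : a₁ = 0 := by linarith
    have e₂ : a₂ = 0 := by linarith
    simp [e₁, e₂]
  have ht : 0 < t₁ + t₂ := by
    rcases ht₁.eq_or_lt with e | e
    · rcases ht₂.eq_or_lt with e' | e'
      · rw [h₁ e.symm, h₂ e'.symm] at h; simp at h
      · linarith
    · linarith
  have hr : 0 < (a₁ + a₂) / (t₁ + t₂) := div_pos h ht
  have k₁ := tangent_le_mul_log_div ha₁ ht₁ h₁ hr
  have k₂ := tangent_le_mul_log_div ha₂ ht₂ h₂ hr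
  have k : (a₁ + a₂) / (t₁ + t₂) * t₁ + (a₁ + a₂) / (t₁ + t₂) * t₂ = a₁ + a₂ := by
    rw [← mul_add, div_mul_cancel₀ _ ht.ne']
  linarith

/-- The equality case of the log-sum inequality. -/
lemma eq_of_le_log_sum {a₁ a₂ t₁ t₂ : ℝ} (ha₁ : 0 ≤ a₁) (ha₂ : 0 ≤ a₂) (ht₁ : 0 < t₁)
    (ht₂ : 0 < t₂) (hle : a₁ * Real.log (a₁ / t₁) + a₂ * Real.log (a₂ / t₂) ≤
      (a₁ + a₂) * Real.log ((a₁ + a₂) / (t₁ + t₂))) : a₁ / t₁ = a₂ / t₂ := by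
  rcases (add_nonneg ha₁ ha₂).eq_or_lt with h | h
  · have e₁ : a₁ = 0 := by linarith
    have e₂ : a₂ = 0 := by linarith
    simp [e₁, e₂]
  have ht : 0 < t₁ + t₂ := by linarith
  have hr : 0 < (a₁ + a₂) / (t₁ + t₂) := div_pos h ht
  have h₁ : t₁ = 0 → a₁ = 0 := fun h => absurd h ht₁.ne'
  have h₂ : t₂ = 0 → a₂ = 0 := fun h => absurd h ht₂.ne'
  have k₁ := tangent_le_mul_log_div ha₁ ht₁.le h₁ hr
  have k₂ := tangent_le_mul_log_div ha₂ ht₂.le h₂ hr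
  have k : (a₁ + a₂) / (t₁ + t₂) * t₁ + (a₁ + a₂) / (t₁ + t₂) * t₂ = a₁ + a₂ := by
    rw [← mul_add, div_mul_cancel₀ _ ht.ne']
  have e₁ := eq_mul_of_mul_log_div_le ha₁ ht₁.le h₁ hr (by linarith)
  have e₂ := eq_mul_of_mul_log_div_le ha₂ ht₂.le h₂ hr (by linarith)
  rw [(div_eq_iff ht₁.ne').2 e₁, (div_eq_iff ht₂.ne').2 e₂]

/-- Together with `infoDensity_smul` this says that the information density is sublinear in `v`.
Convexity of mutual information in the kernel follows by integration. -/
lemma infoDensity_add_le {q v w : X → ℝ} (hq : 0 ≤ q) (hv : 0 ≤ v) (hw : 0 ≤ w) :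
    infoDensity q (v + w) ≤ infoDensity q v + infoDensity q w := by
  simp only [infoDensity, ← Finset.sum_add_distrib, ← mul_add, mix_add, Pi.add_apply]
  refine Finset.sum_le_sum fun x _ => ?_
  rcases (hq x).eq_or_lt with h | h
  · simp [← h]
  · exact mul_le_mul_of_nonneg_left (log_sum_le (hv x) (hw x) (mix_nonneg hq hv)
      (mix_nonneg hq hw) (eq_zero_of_mix_eq_zero hq hv h) (eq_zero_of_mix_eq_zero hq hw h)) h.le

/-- Replacing the output density by that of another input law increases the information density,
up to the difference of the output densities. -/
lemma infoDensity_le {p q v : X → ℝ} (hp : 0 ≤ p) (hq : 0 ≤ q) (hpq : ∀ x, 0 < p x → 0 < q x)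
    (hv : 0 ≤ v) :
    infoDensity p v ≤
      ∑ x, p x * (v x * Real.log (v x / mix q v)) + (mix q v - mix p v) := by
  rcases (mix_nonneg hp hv).eq_or_lt with h0 | h0
  · have : ∀ x, p x * v x = 0 := fun x =>
      le_antisymm (h0 ▸ mul_le_mix hp hv x) (mul_nonneg (hp x) (hv x))
    simp only [infoDensity, ← mul_assoc, this, ← h0]
    simpa using mix_nonneg hq hv
  have hne : mix q v ≠ 0 := fun h => h0.ne' <| Finset.sum_eq_zero fun x _ => by
    rcases (hp x).eq_or_lt with h' | h'
    · simp [← h']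
    · simp [eq_zero_of_mix_eq_zero hq hv (hpq x h') h]
  have hterm : ∀ x, p x * (v x * Real.log (v x / mix q v)) =
      p x * (v x * Real.log (v x / mix p v)) + p x * v x * Real.log (mix p v / mix q v) := by
    intro x
    rcases eq_or_ne (v x) 0 with h | h
    · simp [h]
    · rw [Real.log_div h hne, Real.log_div h h0.ne', Real.log_div h0.ne' hne]; ring
  -- The gap is `m_p * log (m_p / m_q) + m_q - m_p`, with `m_p` and `m_q` the two output densities.
  -- It is nonnegative even when the input vectors have different total masses.
  have k := sub_le_mul_log_div h0.le (mix_nonneg hq hv) (fun h => absurd h hne)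
  simp only [hterm, Finset.sum_add_distrib, ← Finset.sum_mul]
  change infoDensity p v ≤ infoDensity p v + mix p v * _ + _
  linarith

/-! ### Mutual information through densities -/

/-- `f x` is a bounded density of `W x` with respect to `ρ`, for every letter `x` of positive
mass. -/
structure IsDensity (q : X → ℝ) (W : RepKernel X Z) (ρ : Measure Z) (f : X → Z → ℝ) : Prop where
  meas : ∀ x, Measurable (f x)
  nonneg : ∀ z, 0 ≤ fun x => f x z
  bdd : ∃ C, ∀ x z, f x z ≤ C
  eq : ∀ x, 0 < q x → (W x : Measure Z) = ρ.withDensity fun z => ENNReal.ofReal (f x z)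

lemma IsDensity.measurable_mix {q : X → ℝ} {W : RepKernel X Z} {ρ : Measure Z} {f : X → Z → ℝ}
    (h : IsDensity q W ρ f) (p : X → ℝ) : Measurable fun z => mix p fun x => f x z :=
  Finset.measurable_sum _ fun x _ => (h.meas x).const_mul _

lemma marginal_nonneg {P : S × X → ℝ} (hP : 0 ≤ P) : 0 ≤ marginal P :=
  fun _ => Finset.sum_nonneg fun _ _ => hP _

lemma sum_marginal (P : S × X → ℝ) : ∑ x, marginal P x = mass P := by
  simp only [marginal, mass, Fintype.sum_prod_type]
  exact Finset.sum_comm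

lemma output_eq_withDensity {P : S × X → ℝ} (hP : 0 ≤ P) {W : RepKernel X Z} {ρ : Measure Z}
    {f : X → Z → ℝ} (h : IsDensity (marginal P) W ρ f) :
    output P W = ρ.withDensity fun z => ENNReal.ofReal (mix (marginal P) fun x => f x z) := by
  have h1 : (fun z => ENNReal.ofReal (mix (marginal P) fun x => f x z)) =
      ∑ x, fun z => ENNReal.ofReal (marginal P x) * ENNReal.ofReal (f x z) := by
    ext z
    rw [mix, ENNReal.ofReal_sum_of_nonneg fun x _ =>
      mul_nonneg (marginal_nonneg hP x) (h.nonneg z x), Finset.sum_apply]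
    exact Finset.sum_congr rfl fun x _ => ENNReal.ofReal_mul (marginal_nonneg hP x)
  have h2 : ∀ s : Finset X, ρ.withDensity
      (∑ x ∈ s, fun z => ENNReal.ofReal (marginal P x) * ENNReal.ofReal (f x z)) =
      ∑ x ∈ s, ENNReal.ofReal (marginal P x) • (W x : Measure Z) := by
    classical
    intro s
    induction s using Finset.induction_on with
    | empty => simp
    | insert x s hx ih =>
      rw [Finset.sum_insert hx, Finset.sum_insert hx, withDensity_add_left, ih]
      · congr 1
        rcases (marginal_nonneg hP x).eq_or_lt with h0 | h0
        · simp only [Pi.zero_apply] at h0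
          simp [← h0]
        · rw [h.eq x h0, ← withDensity_smul _ (h.meas x).ennreal_ofReal]
          rfl
      · exact ((h.meas x).ennreal_ofReal).const_mul _
  rw [h1, h2, output]

/-! ### Integrability and integral formulas for information quantities -/

section

variable {P : S × X → ℝ} {W : RepKernel X Z} {ρ : Measure Z} {f : X → Z → ℝ}

lemma IsDensity.integrable [IsFiniteMeasure ρ] {q : X → ℝ} (h : IsDensity q W ρ f) (x : X) :
    Integrable (f x) ρ := by
  obtain ⟨C, hC⟩ := h.bdd
  refine Integrable.of_bound (h.meas x).aestronglyMeasurable C (.of_forall fun z => ?_)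
  rw [Real.norm_of_nonneg (h.nonneg z x)]
  exact hC x z

lemma IsDensity.integral_eq_one {q : X → ℝ} (h : IsDensity q W ρ f) {x : X} (hx : 0 < q x) :
    ∫ z, f x z ∂ρ = 1 := by
  have h1 : (W x : Measure Z) Set.univ = 1 := measure_univ
  rw [h.eq x hx, withDensity_apply _ MeasurableSet.univ, Measure.restrict_univ] at h1
  rw [integral_eq_lintegral_of_nonneg_ae (.of_forall fun z => h.nonneg z x)
    (h.meas x).aestronglyMeasurable, h1]
  rfl

lemma IsDensity.integral_mix [IsFiniteMeasure ρ] {q : X → ℝ} (h : IsDensity q W ρ f)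
    {p : X → ℝ} (hpq : ∀ x, p x ≠ 0 → 0 < q x) :
    Integrable (fun z => mix p fun x => f x z) ρ ∧ ∫ z, mix p (fun x => f x z) ∂ρ = ∑ x, p x := by
  have hi : ∀ x, Integrable (fun z => p x * f x z) ρ := fun x => (h.integrable x).const_mul _
  refine ⟨integrable_finsetSum _ fun x _ => hi x, ?_⟩
  simp only [mix]
  rw [integral_finsetSum _ fun x _ => hi x]
  refine Finset.sum_congr rfl fun x _ => ?_
  rcases eq_or_ne (p x) 0 with h0 | h0
  · simp [h0]
  · rw [integral_const_mul, h.integral_eq_one (hpq x h0), mul_one]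

/-- The integrand is bounded: above because the ratio of densities is at most `1 / q x`, below by
the tangent bound `a - t ≤ a * log (a / t)`. -/
lemma IsDensity.integrable_mul_log [IsFiniteMeasure ρ] {q : X → ℝ} (hq : 0 ≤ q)
    (h : IsDensity q W ρ f) {x : X} (hx : 0 < q x) :
    Integrable (fun z => f x z * Real.log (f x z / mix q fun x => f x z)) ρ := by
  obtain ⟨C, hC⟩ := h.bdd
  have hm : ∀ z, mix q (fun x => f x z) ≤ ∑ x, q x * C := fun z =>
    Finset.sum_le_sum fun x _ => mul_le_mul_of_nonneg_left (hC x z) (hq x)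
  refine Integrable.of_bound (C := max (C * |Real.log (1 / q x)|) (∑ x, q x * C))
    ((h.meas x).mul (((h.meas x).div (h.measurable_mix q)).log)).aestronglyMeasurable
    (.of_forall fun z => ?_)
  have hf : 0 ≤ f x z := h.nonneg z x
  have hmix := mix_nonneg hq (h.nonneg z)
  have hz := eq_zero_of_mix_eq_zero hq (h.nonneg z) hx
  rw [Real.norm_eq_abs, abs_le]
  constructor
  · have := sub_le_mul_log_div hf hmix hz
    have := le_max_right (C * |Real.log (1 / q x)|) (∑ x, q x * C)
    linarith [hm z]
  · refine le_trans ?_ (le_max_left _ _)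
    rcases hf.eq_or_lt with h0 | h0
    · rw [← h0, zero_mul]
      exact mul_nonneg (hf.trans (hC x z)) (abs_nonneg _)
    · have hmix' : 0 < mix q fun x => f x z := lt_of_le_of_ne hmix fun h' => h0.ne' (hz h'.symm)
      have h1 : Real.log (f x z / mix q fun x => f x z) ≤ Real.log (1 / q x) := by
        refine Real.log_le_log (div_pos h0 hmix') ?_
        rw [div_le_div_iff₀ hmix' hx, one_mul, mul_comm]
        exact mul_le_mix hq (h.nonneg z) x
      exact (mul_le_mul_of_nonneg_left (h1.trans (le_abs_self _)) hf).trans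
        (mul_le_mul_of_nonneg_right (hC x z) (abs_nonneg _))

lemma IsDensity.integrable_infoDensity [IsFiniteMeasure ρ] {q : X → ℝ} (hq : 0 ≤ q)
    (h : IsDensity q W ρ f) : Integrable (fun z => infoDensity q fun x => f x z) ρ := by
  refine integrable_finsetSum _ fun x _ => ?_
  rcases (hq x).eq_or_lt with h0 | h0
  · simp only [Pi.zero_apply] at h0
    simp [← h0]
  · exact (h.integrable_mul_log hq h0).const_mul _

/-- Relative entropy to the output measure, in terms of densities. -/
lemma IsDensity.relEntropy_eq [IsFiniteMeasure ρ] (hP : 0 ≤ P)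
    (h : IsDensity (marginal P) W ρ f) {x : X} (hx : 0 < marginal P x) (b : ℝ) :
    relEntropy b (W x : Measure Z) (output P W) =
      (∫ z, f x z * Real.log (f x z / mix (marginal P) fun x => f x z) ∂ρ) / Real.log b := by
  have hq := marginal_nonneg hP
  set g : Z → ℝ := fun z => mix (marginal P) fun x => f x z with hg
  have hgm : Measurable g := h.measurable_mix _
  have hout : output P W = ρ.withDensity fun z => ENNReal.ofReal (g z) :=
    output_eq_withDensity hP h
  have hgi : Integrable g ρ := (h.integral_mix (p := marginal P)
    fun x hx => lt_of_le_of_ne (hq x) hx.symm).1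
  have : IsFiniteMeasure (output P W) := by
    rw [hout]
    exact isFiniteMeasure_withDensity_ofReal hgi.2
  have hfg : Measurable fun z => f x z / g z := (h.meas x).div hgm
  have hW : (W x : Measure Z) = (output P W).withDensity fun z => ENNReal.ofReal (f x z / g z) := by
    rw [hout, ← withDensity_mul _ hgm.ennreal_ofReal hfg.ennreal_ofReal,
      h.eq x hx]
    congr 1
    ext z
    have hg0 : 0 ≤ g z := mix_nonneg hq (h.nonneg z)
    rw [Pi.mul_apply, ← ENNReal.ofReal_mul hg0]
    rcases eq_or_ne (g z) 0 with h0 | h0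
    · rw [eq_zero_of_mix_eq_zero hq (h.nonneg z) hx h0]; simp
    · rw [mul_div_cancel₀ _ h0]
  have hac : (W x : Measure Z) ≪ output P W := hW ▸ withDensity_absolutelyContinuous _ _
  have hrn : (W x : Measure Z).rnDeriv (output P W) =ᵐ[(W x : Measure Z)]
      fun z => ENNReal.ofReal (f x z / g z) := by
    refine hac.ae_eq ?_
    conv_lhs => rw [hW]
    exact Measure.rnDeriv_withDensity _ hfg.ennreal_ofReal
  rw [relEntropy]
  congr 1
  have h1 : ∫ z, llr (W x : Measure Z) (output P W) z ∂(W x : Measure Z) =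
      ∫ z, Real.log (f x z / g z) ∂(W x : Measure Z) := by
    refine integral_congr_ae ?_
    filter_upwards [hrn] with z hz
    rw [llr, hz, ENNReal.toReal_ofReal (div_nonneg (h.nonneg z x) (mix_nonneg hq (h.nonneg z)))]
  rw [h1, h.eq x hx, integral_withDensity_eq_integral_toReal_smul (h.meas x).ennreal_ofReal
    (.of_forall fun _ => ENNReal.ofReal_lt_top)]
  refine integral_congr_ae (.of_forall fun z => ?_)
  simp only [smul_eq_mul]
  rw [ENNReal.toReal_ofReal (h.nonneg z x)]

/-- Mutual information in terms of densities. -/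
lemma IsDensity.mutualInfo_eq [IsFiniteMeasure ρ] (hP : 0 ≤ P)
    (h : IsDensity (marginal P) W ρ f) (b : ℝ) :
    mutualInfo b P W = (∫ z, infoDensity (marginal P) (fun x => f x z) ∂ρ) / Real.log b := by
  have hq := marginal_nonneg hP
  simp only [infoDensity]
  rw [integral_finsetSum, mutualInfo, Finset.sum_div]
  · refine Finset.sum_congr rfl fun x _ => ?_
    rcases (hq x).eq_or_lt with h0 | h0
    · simp only [Pi.zero_apply] at h0
      simp [← h0]
    · rw [h.relEntropy_eq hP h0, integral_const_mul, mul_div_assoc]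
  · intro x _
    rcases (hq x).eq_or_lt with h0 | h0
    · simp only [Pi.zero_apply] at h0
      simp [← h0]
    · exact (h.integrable_mul_log hq h0).const_mul _

end

/-- Finitely many kernels have bounded densities with respect to a common finite measure. -/
lemma exists_isDensity (W V : RepKernel X Z) :
    ∃ (ρ : Measure Z) (f g : X → Z → ℝ), IsFiniteMeasure ρ ∧
      (∀ q, IsDensity q W ρ f) ∧ ∀ q, IsDensity q V ρ g := by
  set ρ : Measure Z := ∑ x, ((W x : Measure Z) + (V x : Measure Z)) with hρ
  have hfin : IsFiniteMeasure ρ := inferInstance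
  have hle : ∀ x, (W x : Measure Z) + (V x : Measure Z) ≤ ρ := fun x =>
    Finset.single_le_sum (f := fun x => (W x : Measure Z) + (V x : Measure Z))
      (fun x _ => Measure.zero_le _) (Finset.mem_univ x)
  -- Each kernel measure is dominated by `ρ`, so its derivative is at most `1` almost everywhere.
  -- Truncating at `1` makes the bound hold everywhere without changing the measure.
  have key : ∀ U : RepKernel X Z, (∀ x, (U x : Measure Z) ≤ ρ) → ∀ q,
      IsDensity q U ρ fun x z => min ((U x : Measure Z).rnDeriv ρ z).toReal 1 := by
    intro U hU q
    refine ⟨fun x => (Measure.measurable_rnDeriv _ _).ennreal_toReal.min measurable_const,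
      fun z x => le_min ENNReal.toReal_nonneg zero_le_one, ⟨1, fun x z => min_le_right _ _⟩,
      fun x _ => ?_⟩
    conv_lhs => rw [← Measure.withDensity_rnDeriv_eq _ _ (hU x).absolutelyContinuous]
    refine withDensity_congr_ae ?_
    filter_upwards [Measure.rnDeriv_le_one_of_le (hU x)] with z hz
    have hz' : (U x : Measure Z).rnDeriv ρ z ≤ 1 := hz
    rw [min_eq_left (ENNReal.toReal_le_of_le_ofReal zero_le_one (by simpa using hz')),
      ENNReal.ofReal_toReal (hz'.trans_lt ENNReal.one_lt_top).ne]
  refine ⟨ρ, _, _, hfin, key W fun x => ?_, key V fun x => ?_⟩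
  · exact (Measure.le_add_right le_rfl).trans (hle x)
  · exact (Measure.le_add_left le_rfl).trans (hle x)

/-! ### Distortion -/

/-- The marginal cancels the denominator of the conditional law. If the marginal vanishes then so
does each mass, and the default value of the division is harmless. The distortion is thus linear in
the masses. -/
lemma expDistortion_eq {dist : S → Z → ℝ≥0∞} (hdist : ∀ s, Measurable (dist s)) {Q : S × X → ℝ}
    (hQ : 0 ≤ Q) (W : RepKernel X Z) :
    expDistortion dist Q W = ∑ y, ENNReal.ofReal (Q y) * condDistortion dist W y.1 y.2 := by
  rw [expDistortion, Fintype.sum_prod_type_right]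
  refine Finset.sum_congr rfl fun x _ => ?_
  simp only [surrogate]
  rw [lintegral_finsetSum _ fun s _ => (hdist s).const_mul _, Finset.mul_sum]
  refine Finset.sum_congr rfl fun s _ => ?_
  rw [lintegral_const_mul _ (hdist s), ← mul_assoc,
    ← ENNReal.ofReal_mul (marginal_nonneg hQ x), condDistortion]
  congr 2
  rcases eq_or_ne (marginal Q x) 0 with h | h
  · have : Q (s, x) ≤ marginal Q x :=
      Finset.single_le_sum (f := fun s => Q (s, x)) (fun s _ => hQ _) (Finset.mem_univ s)
    rw [h] at this
    rw [h, zero_mul]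
    exact (le_antisymm this (hQ (s, x))).symm
  · rw [cond, mul_div_cancel₀ _ h]

lemma expDistortion_ne_top_iff {dist : S → Z → ℝ≥0∞} (hdist : ∀ s, Measurable (dist s))
    {Q : S × X → ℝ} (hQ : 0 ≤ Q) (W : RepKernel X Z) :
    expDistortion dist Q W ≠ ∞ ↔ ∀ y, 0 < Q y → condDistortion dist W y.1 y.2 ≠ ∞ := by
  rw [expDistortion_eq hdist hQ, ENNReal.sum_ne_top]
  refine ⟨fun h y hy h' => h y (Finset.mem_univ y) ?_, fun h y _ => ?_⟩
  · rw [h', ENNReal.mul_top (by simpa using hy)]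
  · rcases (hQ y).eq_or_lt with h0 | h0
    · simp only [Pi.zero_apply] at h0
      simp [← h0]
    · exact ENNReal.mul_ne_top ENNReal.ofReal_ne_top (h y h0)

lemma toReal_expDistortion {dist : S → Z → ℝ≥0∞} (hdist : ∀ s, Measurable (dist s))
    {Q : S × X → ℝ} (hQ : 0 ≤ Q) {W : RepKernel X Z} (h : expDistortion dist Q W ≠ ∞) :
    (expDistortion dist Q W).toReal = expect Q fun y => (condDistortion dist W y.1 y.2).toReal := by
  rw [expDistortion_eq hdist hQ] at h ⊢
  rw [ENNReal.toReal_sum (ENNReal.sum_ne_top.1 h), expect]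
  refine Finset.sum_congr rfl fun y _ => ?_
  rw [ENNReal.toReal_mul, ENNReal.toReal_ofReal (hQ y)]

lemma feasible_iff {dist : S → Z → ℝ≥0∞} (hdist : ∀ s, Measurable (dist s))
    {Q : S × X → ℝ} (hQ : 0 ≤ Q) {δ : ℝ} {W : RepKernel X Z} :
    Feasible dist Q δ W ↔ (∀ y, 0 < Q y → condDistortion dist W y.1 y.2 ≠ ∞) ∧
      expect Q (fun y => (condDistortion dist W y.1 y.2).toReal) ≤ δ * mass Q := by
  rw [← expDistortion_ne_top_iff hdist hQ]
  exact and_congr_right fun h => by rw [toReal_expDistortion hdist hQ h]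

lemma mass_nonneg {Q : S × X → ℝ} (hQ : 0 ≤ Q) : 0 ≤ mass Q := Finset.sum_nonneg fun y _ => hQ y

lemma Feasible.mono {dist : S → Z → ℝ≥0∞} {Q : S × X → ℝ} (hQ : 0 ≤ Q) {δ δ' : ℝ}
    {W : RepKernel X Z} (h : Feasible dist Q δ W) (hδ : δ ≤ δ') : Feasible dist Q δ' W :=
  ⟨h.1, h.2.trans (mul_le_mul_of_nonneg_right hδ (mass_nonneg hQ))⟩

/-! ### Mutual information -/

lemma marginal_smul (k : ℝ) (Q : S × X → ℝ) : marginal (k • Q) = k • marginal Q := by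
  ext x; simp [marginal, Finset.mul_sum]

lemma mass_smul (k : ℝ) (Q : S × X → ℝ) : mass (k • Q) = k * mass Q := by
  simp [mass, Finset.mul_sum]

section

variable {b : ℝ} {P Q : S × X → ℝ}

/-- Integrating `a - t ≤ a * log (a / t)` gives the difference of the total masses. For a vector of
mass one this is nonnegativity of relative entropy. -/
lemma le_relEntropy (hb : 0 < Real.log b) (hQ : 0 ≤ Q) (W : RepKernel X Z) {x : X}
    (hx : 0 < marginal Q x) :
    (1 - mass Q) / Real.log b ≤ relEntropy b (W x : Measure Z) (output Q W) := by
  obtain ⟨ρ, f, -, hρ, hf, -⟩ := exists_isDensity W W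
  have h := hf (marginal Q)
  have hq := marginal_nonneg hQ
  have hmix := h.integral_mix (p := marginal Q) fun x hx => lt_of_le_of_ne (hq x) hx.symm
  rw [h.relEntropy_eq hQ hx]
  gcongr
  rw [← h.integral_eq_one hx, ← sum_marginal, ← hmix.2, ← integral_sub (h.integrable x) hmix.1]
  exact integral_mono ((h.integrable x).sub hmix.1) (h.integrable_mul_log hq hx) fun z =>
    sub_le_mul_log_div (h.nonneg z x) (mix_nonneg hq (h.nonneg z))
      (eq_zero_of_mix_eq_zero hq (h.nonneg z) hx)

lemma le_mutualInfo (hb : 0 < Real.log b) (hQ : 0 ≤ Q) (W : RepKernel X Z) :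
    mass Q * ((1 - mass Q) / Real.log b) ≤ mutualInfo b Q W := by
  rw [← sum_marginal, Finset.sum_mul, sum_marginal]
  refine Finset.sum_le_sum fun x _ => ?_
  rcases (marginal_nonneg hQ x).eq_or_lt with h0 | h0
  · simp only [Pi.zero_apply] at h0
    simp [← h0]
  · exact mul_le_mul_of_nonneg_left (le_relEntropy hb hQ W h0) h0.le

/-- Mutual information is at most the mean relative entropy to another output measure, up to the
difference of the total masses. -/
lemma mutualInfo_le_sum_relEntropy (hb : 0 < Real.log b) (hP : 0 ≤ P) (hQ : 0 ≤ Q)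
    (hPQ : ∀ x, 0 < marginal P x → 0 < marginal Q x) (W : RepKernel X Z) :
    mutualInfo b P W ≤ ∑ x, marginal P x * relEntropy b (W x : Measure Z) (output Q W) +
      (mass Q - mass P) / Real.log b := by
  obtain ⟨ρ, f, -, hρ, hf, -⟩ := exists_isDensity W W
  have hp := marginal_nonneg hP
  have hq := marginal_nonneg hQ
  have h := hf (marginal Q)
  have hmq := h.integral_mix (p := marginal Q) fun x hx => lt_of_le_of_ne (hq x) hx.symm
  have hmp := (hf (marginal P)).integral_mix (p := marginal P)
    fun x hx => lt_of_le_of_ne (hp x) hx.symm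
  have hi : ∀ x, Integrable (fun z => marginal P x *
      (f x z * Real.log (f x z / mix (marginal Q) fun x => f x z))) ρ := fun x => by
    rcases (hp x).eq_or_lt with h0 | h0
    · simp only [Pi.zero_apply] at h0
      simp [← h0]
    · exact (h.integrable_mul_log hq (hPQ x h0)).const_mul _
  have hsum : ∑ x, marginal P x * relEntropy b (W x : Measure Z) (output Q W) =
      (∫ z, ∑ x, marginal P x *
        (f x z * Real.log (f x z / mix (marginal Q) fun x => f x z)) ∂ρ) / Real.log b := by
    rw [integral_finsetSum _ fun x _ => hi x, Finset.sum_div]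
    refine Finset.sum_congr rfl fun x _ => ?_
    rcases (hp x).eq_or_lt with h0 | h0
    · simp only [Pi.zero_apply] at h0
      simp [← h0]
    · rw [h.relEntropy_eq hQ (hPQ x h0), integral_const_mul, mul_div_assoc]
  rw [hsum, (hf (marginal P)).mutualInfo_eq hP, ← add_div]
  gcongr
  rw [← sum_marginal Q, ← sum_marginal P, ← hmq.2, ← hmp.2, ← integral_sub hmq.1 hmp.1,
    ← integral_add (g := fun z => (mix (marginal Q) fun x => f x z) - mix (marginal P) fun x => f x z)
      (integrable_finsetSum _ fun x _ => hi x) (hmq.1.sub hmp.1)]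
  exact integral_mono ((hf (marginal P)).integrable_infoDensity hp)
    ((integrable_finsetSum _ fun x _ => hi x).add (hmq.1.sub hmp.1)) fun z =>
    infoDensity_le hp hq hPQ (h.nonneg z)

/-- Mutual informations for two comparable input vectors. -/
lemma mutualInfo_le_mul (hb : 0 < Real.log b) (hP : 0 ≤ P) (hQ : 0 ≤ Q) {c : ℝ}
    (hPQ : ∀ x, marginal P x ≤ c * marginal Q x) (W : RepKernel X Z) :
    mutualInfo b P W ≤ c * mutualInfo b Q W +
      (c * (mass Q * (mass Q - 1)) + mass Q * (1 - mass P)) / Real.log b := by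
  have hp := marginal_nonneg hP
  have hq := marginal_nonneg hQ
  have h0 : ∀ x, 0 < marginal P x → 0 < marginal Q x := fun x hx =>
    lt_of_le_of_ne (hq x) fun h => by
      have := hPQ x
      rw [← h, mul_zero] at this
      linarith
  set L := Real.log b
  -- The shift by `(mass Q - 1) / L` makes every bracket nonnegative by `le_relEntropy`, so the
  -- weights may be enlarged from `marginal P x` to `c * marginal Q x`.
  have key : ∑ x, marginal P x * (relEntropy b (W x : Measure Z) (output Q W) + (mass Q - 1) / L) ≤
      ∑ x, c * (marginal Q x *
        (relEntropy b (W x : Measure Z) (output Q W) + (mass Q - 1) / L)) := by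
    refine Finset.sum_le_sum fun x _ => ?_
    rcases (hp x).eq_or_lt with h1 | h1
    · simp only [Pi.zero_apply] at h1
      rcases (hq x).eq_or_lt with h2 | h2
      · simp only [Pi.zero_apply] at h2
        simp [← h1, ← h2]
      · have h3 := le_relEntropy hb hQ W h2
        have h4 : 0 ≤ relEntropy b (W x : Measure Z) (output Q W) + (mass Q - 1) / L := by
          have : (mass Q - 1) / L = - ((1 - mass Q) / L) := by ring
          linarith
        rw [← mul_assoc]
        exact mul_le_mul_of_nonneg_right (hPQ x) h4
    · have h3 := le_relEntropy hb hQ W (h0 x h1)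
      have h4 : 0 ≤ relEntropy b (W x : Measure Z) (output Q W) + (mass Q - 1) / L := by
        have : (mass Q - 1) / L = - ((1 - mass Q) / L) := by ring
        linarith
      rw [← mul_assoc]
      exact mul_le_mul_of_nonneg_right (hPQ x) h4
  simp only [mul_add, Finset.sum_add_distrib, ← Finset.sum_mul, ← Finset.mul_sum,
    sum_marginal] at key
  have k := mutualInfo_le_sum_relEntropy hb hP hQ h0 W
  have e : ∑ x, marginal Q x * relEntropy b (W x : Measure Z) (output Q W) = mutualInfo b Q W := rfl
  rw [e] at key
  have e2 : (c * (mass Q * (mass Q - 1)) + mass Q * (1 - mass P)) / L =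
      c * (mass Q * ((mass Q - 1) / L)) - mass P * ((mass Q - 1) / L) + (mass Q - mass P) / L := by
    field_simp; ring
  rw [e2]
  linarith

/-- The output density is also multiplied by `k`, so each logarithm loses `log k`. This describes
how the unnormalized quantities deviate from homogeneity. -/
lemma mutualInfo_smul (hQ : 0 ≤ Q) {k : ℝ} (hk : 0 < k) (W : RepKernel X Z) :
    mutualInfo b (k • Q) W =
      k * mutualInfo b Q W - k * Real.log k * mass Q / Real.log b := by
  obtain ⟨ρ, f, -, hρ, hf, -⟩ := exists_isDensity W W
  have hq := marginal_nonneg hQ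
  have h := hf (marginal Q)
  have hmq := h.integral_mix (p := marginal Q) fun x hx => lt_of_le_of_ne (hq x) hx.symm
  have hkQ : 0 ≤ k • Q := smul_nonneg hk.le hQ
  rw [(hf (marginal (k • Q))).mutualInfo_eq hkQ, h.mutualInfo_eq hQ, mul_div_assoc', ← sub_div,
    ← sum_marginal, ← hmq.2, ← integral_const_mul, ← integral_const_mul,
    ← integral_sub ((h.integrable_infoDensity hq).const_mul _) (hmq.1.const_mul _)]
  congr 2
  ext z
  rw [marginal_smul]
  have hm : mix (k • marginal Q) (fun x => f x z) = k * mix (marginal Q) fun x => f x z := by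
    simp [mix, Finset.mul_sum, mul_assoc]
  simp only [infoDensity, hm]
  conv_rhs => rw [mix, Finset.mul_sum, Finset.mul_sum, ← Finset.sum_sub_distrib]
  refine Finset.sum_congr rfl fun x _ => ?_
  simp only [Pi.smul_apply, smul_eq_mul]
  rcases eq_or_ne (f x z) 0 with h1 | h1
  · simp [h1]
  rcases (hq x).eq_or_lt with h2 | h2
  · simp only [Pi.zero_apply] at h2
    simp [← h2]
  have h3 : mix (marginal Q) (fun x => f x z) ≠ 0 := fun h' =>
    h1 (eq_zero_of_mix_eq_zero hq (h.nonneg z) h2 h')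
  change k * marginal Q x * (f x z * Real.log (f x z / (k * mix (marginal Q) fun x => f x z))) =
    k * (marginal Q x * (f x z * Real.log (f x z / mix (marginal Q) fun x => f x z))) -
    k * Real.log k * (marginal Q x * f x z)
  rw [Real.log_div h1 (mul_ne_zero hk.ne' h3), Real.log_mul hk.ne' h3, Real.log_div h1 h3]
  ring

/-- Time sharing between two kernels. -/
lemma exists_timeSharing {dist : S → Z → ℝ≥0∞} (hb : 0 < Real.log b) (hQ : 0 ≤ Q)
    (W V : RepKernel X Z) {t u : ℝ} (ht : 0 ≤ t) (hu : 0 ≤ u) (htu : t + u = 1) :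
    ∃ U : RepKernel X Z,
      (∀ x, (U x : Measure Z) =
        ENNReal.ofReal t • (W x : Measure Z) + ENNReal.ofReal u • (V x : Measure Z)) ∧
      (∀ s x, condDistortion dist U s x = ENNReal.ofReal t * condDistortion dist W s x +
        ENNReal.ofReal u * condDistortion dist V s x) ∧
      mutualInfo b Q U ≤ t * mutualInfo b Q W + u * mutualInfo b Q V := by
  obtain ⟨ρ, f, g, hρ, hf, hg⟩ := exists_isDensity W V
  have hU : ∀ x, IsProbabilityMeasure
      (ENNReal.ofReal t • (W x : Measure Z) + ENNReal.ofReal u • (V x : Measure Z)) := fun x =>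
    ⟨by simp [← ENNReal.ofReal_add ht hu, htu]⟩
  refine ⟨fun x => ⟨_, hU x⟩, fun x => rfl, fun s x => ?_, ?_⟩
  · simp [condDistortion, lintegral_add_measure, lintegral_smul_measure]
  have hq := marginal_nonneg hQ
  have hF := hf (marginal Q)
  have hG := hg (marginal Q)
  have h : IsDensity (marginal Q)
      (fun x => (⟨_, hU x⟩ : ProbabilityMeasure Z)) ρ fun x z => t * f x z + u * g x z := by
    refine ⟨fun x => ((hF.meas x).const_mul _).add ((hG.meas x).const_mul _),
      fun z x => add_nonneg (mul_nonneg ht (hF.nonneg z x)) (mul_nonneg hu (hG.nonneg z x)), ?_,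
      fun x hx => ?_⟩
    · obtain ⟨C, hC⟩ := hF.bdd
      obtain ⟨D, hD⟩ := hG.bdd
      exact ⟨t * C + u * D, fun x z => add_le_add (mul_le_mul_of_nonneg_left (hC x z) ht)
        (mul_le_mul_of_nonneg_left (hD x z) hu)⟩
    · have e : (fun z => ENNReal.ofReal (t * f x z + u * g x z)) =
          (ENNReal.ofReal t • fun z => ENNReal.ofReal (f x z)) +
          ENNReal.ofReal u • fun z => ENNReal.ofReal (g x z) := by
        ext z
        rw [ENNReal.ofReal_add (mul_nonneg ht (hF.nonneg z x)) (mul_nonneg hu (hG.nonneg z x)),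
          ENNReal.ofReal_mul ht, ENNReal.ofReal_mul hu]
        rfl
      rw [e, withDensity_add_left ((hF.meas x).ennreal_ofReal.const_smul _),
        withDensity_smul _ (hF.meas x).ennreal_ofReal,
        withDensity_smul _ (hG.meas x).ennreal_ofReal, ← hF.eq x hx, ← hG.eq x hx]
      rfl
  rw [h.mutualInfo_eq hQ, hF.mutualInfo_eq hQ, hG.mutualInfo_eq hQ, mul_div_assoc', mul_div_assoc',
    ← add_div]
  gcongr
  have iF := (hF.integrable_infoDensity hq).const_mul t
  have iG := (hG.integrable_infoDensity hq).const_mul u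
  rw [← integral_const_mul, ← integral_const_mul, ← integral_add iF iG]
  refine integral_mono (h.integrable_infoDensity hq) (iF.add iG) fun z => ?_
  refine (infoDensity_add_le (v := t • fun x => f x z) (w := u • fun x => g x z) hq
    (smul_nonneg ht (hF.nonneg z)) (smul_nonneg hu (hG.nonneg z))).trans ?_
  rw [infoDensity_smul _ _ ht, infoDensity_smul _ _ hu]

end

/-! ### The rate-distortion function -/

section

variable {b : ℝ} {dist : S → Z → ℝ≥0∞} {P Q : S × X → ℝ}

lemma bddBelow_rate (hb : 0 < Real.log b) (hQ : 0 ≤ Q) (δ : ℝ) :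
    BddBelow {r | ∃ W : RepKernel X Z, Feasible dist Q δ W ∧ r = mutualInfo b Q W} :=
  ⟨_, by rintro r ⟨W, -, rfl⟩; exact le_mutualInfo hb hQ W⟩

lemma rate_le (hb : 0 < Real.log b) (hQ : 0 ≤ Q) {δ : ℝ} {W : RepKernel X Z}
    (h : Feasible dist Q δ W) : rate b dist Q δ ≤ mutualInfo b Q W :=
  csInf_le (bddBelow_rate hb hQ δ) ⟨W, h, rfl⟩

lemma le_rate {δ c : ℝ} (hne : ∃ W : RepKernel X Z, Feasible dist Q δ W)
    (h : ∀ W : RepKernel X Z, Feasible dist Q δ W → c ≤ mutualInfo b Q W) :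
    c ≤ rate b dist Q δ := by
  obtain ⟨W, hW⟩ := hne
  refine le_csInf ⟨_, W, hW, rfl⟩ ?_
  rintro r ⟨V, hV, rfl⟩
  exact h V hV

lemma rate_anti (hb : 0 < Real.log b) (hQ : 0 ≤ Q) {δ δ' : ℝ} (hδ : δ ≤ δ')
    (hne : ∃ W : RepKernel X Z, Feasible dist Q δ W) : rate b dist Q δ' ≤ rate b dist Q δ :=
  le_rate hne fun _ hW => rate_le hb hQ (hW.mono hQ hδ)

lemma Feasible.timeSharing (hdist : ∀ s, Measurable (dist s)) (hQ : 0 ≤ Q)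
    {W V U : RepKernel X Z} {δ ε t u : ℝ} (ht : 0 ≤ t) (hu : 0 ≤ u)
    (hW : Feasible dist Q δ W) (hV : Feasible dist Q ε V)
    (hU : ∀ s x, condDistortion dist U s x = ENNReal.ofReal t * condDistortion dist W s x +
        ENNReal.ofReal u * condDistortion dist V s x) :
    Feasible dist Q (t * δ + u * ε) U := by
  rw [feasible_iff hdist hQ] at *
  refine ⟨fun y hy => ?_, ?_⟩
  · rw [hU]
    exact ENNReal.add_ne_top.2 ⟨ENNReal.mul_ne_top ENNReal.ofReal_ne_top (hW.1 y hy),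
      ENNReal.mul_ne_top ENNReal.ofReal_ne_top (hV.1 y hy)⟩
  · have : expect Q (fun y => (condDistortion dist U y.1 y.2).toReal) =
        t * expect Q (fun y => (condDistortion dist W y.1 y.2).toReal) +
        u * expect Q (fun y => (condDistortion dist V y.1 y.2).toReal) := by
      simp only [expect, Finset.mul_sum, ← Finset.sum_add_distrib]
      refine Finset.sum_congr rfl fun y _ => ?_
      rcases (hQ y).eq_or_lt with h0 | h0
      · simp only [Pi.zero_apply] at h0
        simp [← h0]
      · rw [hU, ENNReal.toReal_add (ENNReal.mul_ne_top ENNReal.ofReal_ne_top (hW.1 y h0))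
          (ENNReal.mul_ne_top ENNReal.ofReal_ne_top (hV.1 y h0)), ENNReal.toReal_mul,
          ENNReal.toReal_mul, ENNReal.toReal_ofReal ht, ENNReal.toReal_ofReal hu]
        ring
    rw [this]
    nlinarith [mul_le_mul_of_nonneg_left hW.2 ht, mul_le_mul_of_nonneg_left hV.2 hu]

/-- Time sharing mixes both distortion levels and bounds the information by the mixture. The infima
over the two kernels are then taken one at a time, since neither need be attained. -/
lemma convexOn_rate (hb : 0 < Real.log b) (hdist : ∀ s, Measurable (dist s)) (hQ : 0 ≤ Q) :
    ConvexOn ℝ {δ | ∃ W : RepKernel X Z, Feasible dist Q δ W} (rate b dist Q) := by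
  rw [convexOn_iff_forall_pos]
  refine ⟨?_, ?_⟩
  · rintro δ ⟨W, hW⟩ ε ⟨V, hV⟩ t u ht hu htu
    obtain ⟨U, -, hU, -⟩ := exists_timeSharing (dist := dist) hb hQ W V ht hu htu
    exact ⟨U, hW.timeSharing hdist hQ ht hu hV hU⟩
  · rintro δ hδ ε hε t u ht hu htu
    simp only [smul_eq_mul]
    have key : ∀ W V : RepKernel X Z, Feasible dist Q δ W → Feasible dist Q ε V →
        rate b dist Q (t * δ + u * ε) ≤ t * mutualInfo b Q W + u * mutualInfo b Q V := by
      intro W V hW hV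
      obtain ⟨U, -, hU, hI⟩ := exists_timeSharing (dist := dist) hb hQ W V ht.le hu.le htu
      exact (rate_le hb hQ (hW.timeSharing hdist hQ ht.le hu.le hV hU)).trans hI
    have k2 : ∀ W : RepKernel X Z, Feasible dist Q δ W →
        rate b dist Q (t * δ + u * ε) ≤ t * mutualInfo b Q W + u * rate b dist Q ε := by
      intro W hW
      have : (rate b dist Q (t * δ + u * ε) - t * mutualInfo b Q W) / u ≤ rate b dist Q ε :=
        le_rate hε fun V hV => by rw [div_le_iff₀ hu]; linarith [key W V hW hV]
      rw [div_le_iff₀ hu] at this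
      linarith
    have : (rate b dist Q (t * δ + u * ε) - u * rate b dist Q ε) / t ≤ rate b dist Q δ :=
      le_rate hδ fun W hW => by rw [div_le_iff₀ ht]; linarith [k2 W hW]
    rw [div_le_iff₀ ht] at this
    linarith

lemma marginal_le_mul {c : ℝ} (hPQ : ∀ y, P y ≤ c * Q y) (x : X) :
    marginal P x ≤ c * marginal Q x := by
  rw [marginal, marginal, Finset.mul_sum]
  exact Finset.sum_le_sum fun s _ => hPQ _

lemma Feasible.of_le_mul (hdist : ∀ s, Measurable (dist s)) (hP : 0 ≤ P) (hQ : 0 ≤ Q) {c : ℝ}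
    (hc : 0 ≤ c) (hPQ : ∀ y, P y ≤ c * Q y) {δ δ' : ℝ}
    (hδ : c * (δ * mass Q) ≤ δ' * mass P) {W : RepKernel X Z} (hW : Feasible dist Q δ W) :
    Feasible dist P δ' W := by
  rw [feasible_iff hdist hP]
  rw [feasible_iff hdist hQ] at hW
  refine ⟨fun y hy => hW.1 y (lt_of_le_of_ne (hQ y) fun h => ?_), ?_⟩
  · have := hPQ y
    rw [← h, mul_zero] at this
    linarith
  · refine le_trans ?_ ((mul_le_mul_of_nonneg_left hW.2 hc).trans hδ)
    rw [expect, expect, Finset.mul_sum]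
    refine Finset.sum_le_sum fun y _ => ?_
    rw [← mul_assoc]
    exact mul_le_mul_of_nonneg_right (hPQ y) ENNReal.toReal_nonneg

/-- Rate-distortion functions of two comparable laws. -/
lemma rate_le_mul (hb : 0 < Real.log b) (hdist : ∀ s, Measurable (dist s)) (hP : 0 ≤ P)
    (hQ : 0 ≤ Q) {c : ℝ} (hc : 0 < c) (hPQ : ∀ y, P y ≤ c * Q y) {δ δ' : ℝ}
    (hδ : c * (δ * mass Q) ≤ δ' * mass P) (hne : ∃ W : RepKernel X Z, Feasible dist Q δ W) :
    rate b dist P δ' ≤ c * rate b dist Q δ +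
      (c * (mass Q * (mass Q - 1)) + mass Q * (1 - mass P)) / Real.log b := by
  have : (rate b dist P δ' - (c * (mass Q * (mass Q - 1)) + mass Q * (1 - mass P)) / Real.log b) / c
      ≤ rate b dist Q δ := le_rate hne fun W hW => by
    rw [div_le_iff₀ hc]
    have h1 := rate_le hb hP (hW.of_le_mul hdist hP hQ hc.le hPQ hδ)
    have h2 := mutualInfo_le_mul hb hP hQ (marginal_le_mul hPQ) W
    linarith
  rw [div_le_iff₀ hc] at this
  linarith

lemma feasible_smul_iff (hdist : ∀ s, Measurable (dist s)) (hQ : 0 ≤ Q) {k : ℝ} (hk : 0 < k)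
    {δ : ℝ} {W : RepKernel X Z} : Feasible dist (k • Q) δ W ↔ Feasible dist Q δ W := by
  have key : ∀ {Q : S × X → ℝ} {k : ℝ}, 0 ≤ Q → 0 < k → Feasible dist Q δ W →
      Feasible dist (k • Q) δ W := fun hQ hk hW =>
    hW.of_le_mul hdist (smul_nonneg hk.le hQ) hQ hk.le (fun y => le_rfl)
      (by rw [mass_smul]; linarith)
  refine ⟨fun h => ?_, key hQ hk⟩
  simpa [smul_smul, hk.ne'] using key (smul_nonneg hk.le hQ) (inv_pos.2 hk) h

lemma rate_smul (hb : 0 < Real.log b) (hdist : ∀ s, Measurable (dist s)) (hQ : 0 ≤ Q) {k : ℝ}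
    (hk : 0 < k) {δ : ℝ} (hne : ∃ W : RepKernel X Z, Feasible dist Q δ W) :
    rate b dist (k • Q) δ = k * rate b dist Q δ - k * Real.log k * mass Q / Real.log b := by
  have hkQ : 0 ≤ k • Q := smul_nonneg hk.le hQ
  apply le_antisymm
  · have : (rate b dist (k • Q) δ + k * Real.log k * mass Q / Real.log b) / k ≤ rate b dist Q δ :=
      le_rate hne fun W hW => by
        rw [div_le_iff₀ hk]
        have := rate_le hb hkQ ((feasible_smul_iff hdist hQ hk).2 hW)
        rw [mutualInfo_smul hQ hk] at this
        linarith
    rw [div_le_iff₀ hk] at this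
    linarith
  · obtain ⟨V, hV⟩ := hne
    refine le_rate ⟨V, (feasible_smul_iff hdist hQ hk).2 hV⟩ fun W hW => ?_
    rw [mutualInfo_smul hQ hk]
    have := mul_le_mul_of_nonneg_left
      (rate_le (b := b) hb hQ ((feasible_smul_iff hdist hQ hk).1 hW)) hk.le
    linarith

lemma isOptimal_smul_iff (hb : 0 < Real.log b) (hdist : ∀ s, Measurable (dist s)) (hQ : 0 ≤ Q)
    {k : ℝ} (hk : 0 < k) {δ : ℝ} {W : RepKernel X Z} :
    IsOptimal b dist (k • Q) δ W ↔ IsOptimal b dist Q δ W := by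
  rw [IsOptimal, IsOptimal, feasible_smul_iff hdist hQ hk]
  refine and_congr_right fun h => ?_
  rw [mutualInfo_smul hQ hk, rate_smul hb hdist hQ hk ⟨W, h⟩, sub_left_inj,
    mul_right_inj' hk.ne']

lemma output_smul {k : ℝ} (hk : 0 ≤ k) (W : RepKernel X Z) :
    output (k • Q) W = ENNReal.ofReal k • output Q W := by
  simp only [output, marginal_smul, Finset.smul_sum, Pi.smul_apply, smul_eq_mul,
    ENNReal.ofReal_mul hk, smul_smul]

/-- A convex function lies above its tangent at a point of differentiability; the sign comes from
monotonicity of the rate. Feasibility at some level below `d` puts `d` inside the domain of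
convexity. -/
lemma slope_nonneg_and_tangent (hb : 0 < Real.log b) (hdist : ∀ s, Measurable (dist s))
    (hQ : 0 ≤ Q) {d : ℝ} (hmin : ∃ δ < d, ∃ V : RepKernel X Z, Feasible dist Q δ V)
    (hd : DifferentiableAt ℝ (fun δ => rate b dist Q δ) d) :
    0 ≤ slope b dist Q d ∧ ∀ δ, (∃ V : RepKernel X Z, Feasible dist Q δ V) →
      rate b dist Q d ≤ rate b dist Q δ + slope b dist Q d * (δ - d) := by
  obtain ⟨δ₀, hδ₀, V, hV⟩ := hmin
  have hconv := convexOn_rate (b := b) hb hdist hQ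
  have hmem : ∀ {ε}, δ₀ ≤ ε → ε ∈ {δ | ∃ W : RepKernel X Z, Feasible dist Q δ W} :=
    fun h => ⟨V, hV.mono hQ h⟩
  have hda := hd.hasDerivAt
  have hs : deriv (fun δ => rate b dist Q δ) d = - slope b dist Q d := by simp [slope]
  rw [hs] at hda
  refine ⟨?_, fun δ hδ => ?_⟩
  · have h1 := hconv.le_slope_of_hasDerivAt (hmem hδ₀.le) (hmem (by linarith : δ₀ ≤ d + 1))
      (by linarith) hda
    rw [slope_def_field, le_div_iff₀ (by linarith)] at h1
    have h2 := rate_anti (b := b) hb hQ (by linarith : d ≤ d + 1) (hmem hδ₀.le)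
    nlinarith
  · rcases lt_trichotomy δ d with h | h | h
    · have h1 := hconv.slope_le_of_hasDerivAt hδ (hmem hδ₀.le) h hda
      rw [slope_def_field, div_le_iff₀ (by linarith)] at h1
      nlinarith
    · simp [h]
    · have h1 := hconv.le_slope_of_hasDerivAt (hmem hδ₀.le) hδ h hda
      rw [slope_def_field, le_div_iff₀ (by linarith)] at h1
      nlinarith

/-- The Lagrangian bound on the rate-distortion function. -/
lemma rate_le_lagrangian (hb : 0 < Real.log b) (hdist : ∀ s, Measurable (dist s))
    (hQ : 0 ≤ Q) (hm : 0 < mass Q) {d : ℝ}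
    (hmin : ∃ δ < d, ∃ V : RepKernel X Z, Feasible dist Q δ V)
    (hd : DifferentiableAt ℝ (fun δ => rate b dist Q δ) d) {W : RepKernel X Z}
    (hW : ∀ y, 0 < Q y → condDistortion dist W y.1 y.2 ≠ ∞) :
    rate b dist Q d ≤ mutualInfo b Q W + slope b dist Q d *
      (expect Q (fun y => (condDistortion dist W y.1 y.2).toReal) / mass Q - d) := by
  -- A kernel is feasible at its own normalized mean distortion; the tangent line at `d` is
  -- evaluated at that level.
  have hf : Feasible dist Q
      (expect Q (fun y => (condDistortion dist W y.1 y.2).toReal) / mass Q) W :=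
    (feasible_iff hdist hQ).2 ⟨hW, by rw [div_mul_cancel₀ _ hm.ne']⟩
  exact ((slope_nonneg_and_tangent hb hdist hQ hmin hd).2 _ ⟨W, hf⟩).trans
    (add_le_add_left (rate_le hb hQ hf) _)

/-- Complementary slackness. -/
lemma IsOptimal.slackness (hb : 0 < Real.log b) (hdist : ∀ s, Measurable (dist s))
    (hQ : 0 ≤ Q) (hm : 0 < mass Q) {d : ℝ}
    (hmin : ∃ δ < d, ∃ V : RepKernel X Z, Feasible dist Q δ V)
    (hd : DifferentiableAt ℝ (fun δ => rate b dist Q δ) d) {W : RepKernel X Z}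
    (hW : IsOptimal b dist Q d W) :
    slope b dist Q d *
      (expect Q (fun y => (condDistortion dist W y.1 y.2).toReal) - d * mass Q) = 0 := by
  have hf := (feasible_iff hdist hQ).1 hW.1
  -- Applied to the optimal kernel itself, the Lagrangian bound makes the slackness term
  -- nonnegative, while feasibility makes it nonpositive.
  have h1 := rate_le_lagrangian hb hdist hQ hm hmin hd hf.1
  rw [hW.2] at h1
  have h0 := (slope_nonneg_and_tangent hb hdist hQ hmin hd).1
  set D := expect Q (fun y => (condDistortion dist W y.1 y.2).toReal)
  have h2 : 0 ≤ slope b dist Q d * (D / mass Q - d) * mass Q :=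
    mul_nonneg (by linarith) hm.le
  have h3 : slope b dist Q d * (D / mass Q - d) * mass Q = slope b dist Q d * (D - d * mass Q) := by
    field_simp
  have h4 : slope b dist Q d * (D - d * mass Q) ≤ 0 :=
    mul_nonpos_of_nonneg_of_nonpos h0 (by linarith [hf.2])
  linarith

end

/-! ### Reweighting an optimal kernel -/

section

variable {b : ℝ} {dist : S → Z → ℝ≥0∞} {P : S × X → ℝ}

lemma marginal_pos (hP : 0 ≤ P) {y : S × X} (hy : 0 < P y) : 0 < marginal P y.2 :=
  hy.trans_le (Finset.single_le_sum (f := fun s => P (s, y.2)) (fun _ _ => hP _)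
    (Finset.mem_univ y.1))

lemma expect_congr (hP : 0 ≤ P) {f g : S × X → ℝ} (h : ∀ y, 0 < P y → f y = g y) :
    expect P f = expect P g := by
  refine Finset.sum_congr rfl fun y _ => ?_
  rcases (hP y).eq_or_lt with h0 | h0
  · simp only [Pi.zero_apply] at h0
    simp [← h0]
  · rw [h y h0]

lemma toReal_condDistortion (hdist : ∀ s, Measurable (dist s)) {W : RepKernel X Z} {s : S} {x : X}
    (h : condDistortion dist W s x ≠ ∞) :
    (condDistortion dist W s x).toReal = ∫ z, (dist s z).toReal ∂(W x : Measure Z) :=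
  (integral_toReal (hdist s).aemeasurable (ae_lt_top (hdist s) h)).symm

/-- The factor `k` depends on `z` only, so it cancels in the ratio of a conditional density to the
output density. The information density is merely multiplied by `k z`, and information and
distortion are linear in `k`. -/
lemma exists_isOptimal_reweight (hb : 0 < Real.log b) (hdist : ∀ s, Measurable (dist s))
    (hP : 0 ≤ P) {d : ℝ} {W : RepKernel X Z} (hW : IsOptimal b dist P d W) {ρ : Measure Z}
    [IsFiniteMeasure ρ] {f : X → Z → ℝ} (hf : IsDensity (marginal P) W ρ f)
    {k : Z → ℝ} (hkm : Measurable k) (hk : 0 ≤ k) {C : ℝ} (hkC : ∀ z, k z ≤ C)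
    (h1 : ∀ x, 0 < marginal P x → ∫ z, k z ∂(W x : Measure Z) = 1)
    (h2 : ∫ z, k z * infoDensity (marginal P) (fun x => f x z) ∂ρ ≤
      ∫ z, infoDensity (marginal P) (fun x => f x z) ∂ρ)
    (h3 : expect P (fun y => ∫ z, k z * (dist y.1 z).toReal ∂(W y.2 : Measure Z)) ≤
      expect P (fun y => ∫ z, (dist y.1 z).toReal ∂(W y.2 : Measure Z))) :
    ∃ V : RepKernel X Z, IsOptimal b dist P d V ∧ ∀ x, 0 < marginal P x →
      (V x : Measure Z) = (W x : Measure Z).withDensity fun z => ENNReal.ofReal (k z) := by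
  classical
  have hprob : ∀ x, 0 < marginal P x → IsProbabilityMeasure
      ((W x : Measure Z).withDensity fun z => ENNReal.ofReal (k z)) := fun x hx => ⟨by
    have hki : Integrable k (W x : Measure Z) :=
      Integrable.of_bound hkm.aestronglyMeasurable C (.of_forall fun z => by
        rw [Real.norm_of_nonneg (hk z)]; exact hkC z)
    rw [withDensity_apply _ MeasurableSet.univ, Measure.restrict_univ,
      ← ofReal_integral_eq_lintegral_ofReal hki (.of_forall hk), h1 x hx, ENNReal.ofReal_one]⟩
  let V : RepKernel X Z := fun x => if hx : 0 < marginal P x then ⟨_, hprob x hx⟩ else W x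
  have hV : ∀ x, 0 < marginal P x →
      (V x : Measure Z) = (W x : Measure Z).withDensity fun z => ENNReal.ofReal (k z) :=
    fun x hx => by simp [V, hx]
  have hWf := (feasible_iff hdist hP).1 hW.1
  have hdV : ∀ y, 0 < P y → condDistortion dist V y.1 y.2 ≠ ∞ ∧
      (condDistortion dist V y.1 y.2).toReal =
        ∫ z, k z * (dist y.1 z).toReal ∂(W y.2 : Measure Z) := by
    intro y hy
    have hx := marginal_pos hP hy
    have hne : condDistortion dist V y.1 y.2 ≠ ∞ := by
      rw [condDistortion, hV _ hx, lintegral_withDensity_eq_lintegral_mul _ hkm.ennreal_ofReal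
        (hdist y.1)]
      refine ne_top_of_le_ne_top (ENNReal.mul_ne_top (ENNReal.ofReal_ne_top (r := C))
        (hWf.1 y hy)) ?_
      rw [condDistortion, ← lintegral_const_mul _ (hdist y.1)]
      exact lintegral_mono fun z => mul_le_mul_left (ENNReal.ofReal_le_ofReal (hkC z)) _
    refine ⟨hne, ?_⟩
    rw [toReal_condDistortion hdist hne, hV _ hx,
      integral_withDensity_eq_integral_toReal_smul hkm.ennreal_ofReal
        (.of_forall fun _ => ENNReal.ofReal_lt_top)]
    refine integral_congr_ae (.of_forall fun z => ?_)
    simp only [smul_eq_mul]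
    rw [ENNReal.toReal_ofReal (hk z)]
  have hVf : Feasible dist P d V := by
    refine (feasible_iff hdist hP).2 ⟨fun y hy => (hdV y hy).1, le_trans ?_ hWf.2⟩
    rwa [expect_congr hP fun y hy => (hdV y hy).2,
      expect_congr hP fun y hy => toReal_condDistortion hdist (hWf.1 y hy)]
  have hg : IsDensity (marginal P) V ρ fun x z => k z * f x z := by
    refine ⟨fun x => hkm.mul (hf.meas x), fun z x => mul_nonneg (hk z) (hf.nonneg z x), ?_,
      fun x hx => ?_⟩
    · obtain ⟨D, hD⟩ := hf.bdd
      exact ⟨C * D, fun x z => mul_le_mul (hkC z) (hD x z) (hf.nonneg z x) ((hk z).trans (hkC z))⟩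
    · rw [hV x hx, hf.eq x hx,
        ← withDensity_mul _ (hf.meas x).ennreal_ofReal hkm.ennreal_ofReal]
      congr 1
      ext z
      rw [Pi.mul_apply, mul_comm, ENNReal.ofReal_mul (hk z)]
  have hIle : mutualInfo b P V ≤ mutualInfo b P W := by
    rw [hg.mutualInfo_eq hP, hf.mutualInfo_eq hP]
    refine div_le_div_of_nonneg_right ?_ hb.le
    refine le_of_eq_of_le (integral_congr_ae (.of_forall fun z => ?_)) h2
    exact infoDensity_smul (marginal P) (fun x => f x z) (hk z)
  exact ⟨V, ⟨hVf, le_antisymm (hIle.trans_eq hW.2) (rate_le hb hP hVf)⟩, hV⟩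

/-- A direction along which the constraints and the objective do not increase can be followed until
the mass of one of the cells vanishes. -/
lemma exists_isOptimal_output_eq_zero (hb : 0 < Real.log b) (hdist : ∀ s, Measurable (dist s))
    (hP : 0 ≤ P) {d : ℝ} {W : RepKernel X Z} (hW : IsOptimal b dist P d W) {ρ : Measure Z}
    [IsFiniteMeasure ρ] {f : X → Z → ℝ} (hf : IsDensity (marginal P) W ρ f)
    {ι : Type*} [Fintype ι] {A : ι → Set Z} (hA : ∀ i, MeasurableSet (A i))
    (hdisj : Pairwise fun i j => Disjoint (A i) (A j)) {a : ι → ℝ} (ha : ∃ i, a i < 0)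
    (h1 : ∀ x, 0 < marginal P x → ∑ i, a i * (W x : Measure Z).real (A i) = 0)
    (h2 : ∑ i, a i * ∫ z in A i, infoDensity (marginal P) (fun x => f x z) ∂ρ ≤ 0)
    (h3 : ∑ i, a i *
      expect P (fun y => ∫ z in A i, (dist y.1 z).toReal ∂(W y.2 : Measure Z)) ≤ 0) :
    ∃ V : RepKernel X Z, IsOptimal b dist P d V ∧ ∃ i, output P V (A i) = 0 := by
  classical
  obtain ⟨i₁, hi₁⟩ := ha
  obtain ⟨i₀, -, hmin⟩ := Finset.exists_min_image Finset.univ a ⟨i₁, Finset.mem_univ i₁⟩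
  have hi₀ : a i₀ < 0 := (hmin i₁ (Finset.mem_univ _)).trans_lt hi₁
  -- This is the largest step for which `1 + τ * a i` stays nonnegative for every `i`: the factor
  -- becomes zero exactly where `a` is minimal.
  set τ : ℝ := (- a i₀)⁻¹ with hτ
  have hτ0 : 0 < τ := inv_pos.2 (neg_pos.2 hi₀)
  have hτ1 : τ * a i₀ = -1 := by
    rw [hτ, inv_neg, neg_mul, inv_mul_cancel₀ hi₀.ne]
  set k : Z → ℝ := fun z => 1 + ∑ i, τ * a i * (A i).indicator 1 z with hk
  have hkA : ∀ i, ∀ z ∈ A i, k z = 1 + τ * a i := by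
    intro i z hz
    simp only [hk]
    rw [Finset.sum_eq_single i]
    · simp [hz]
    · intro j _ hj
      rw [Set.indicator_of_notMem (fun hz' => (hdisj hj).le_bot ⟨hz', hz⟩), mul_zero]
    · simp
  have hkA' : ∀ z, (∀ i, z ∉ A i) → k z = 1 := by
    intro z hz
    simp [hk, hz]
  have hkm : Measurable k :=
    measurable_const.add (Finset.measurable_sum _ fun i _ =>
      (measurable_one.indicator (hA i)).const_mul _)
  have hk0 : 0 ≤ k := by
    intro z
    by_cases h : ∃ i, z ∈ A i
    · obtain ⟨i, hi⟩ := h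
      rw [hkA i z hi]
      have := mul_le_mul_of_nonneg_left (hmin i (Finset.mem_univ _)) hτ0.le
      simp only [Pi.zero_apply]
      linarith
    · push Not at h
      rw [hkA' z h]
      exact zero_le_one
  have hkC : ∀ z, k z ≤ 1 + ∑ i, |τ * a i| := by
    intro z
    refine add_le_add_right (Finset.sum_le_sum fun i _ => ?_) _
    by_cases h : z ∈ A i
    · rw [Set.indicator_of_mem h, Pi.one_apply, mul_one]
      exact le_abs_self _
    · rw [Set.indicator_of_notMem h, mul_zero]
      exact abs_nonneg _
  have hint : ∀ (μ : Measure Z) (F : Z → ℝ), Integrable F μ →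
      ∫ z, k z * F z ∂μ = ∫ z, F z ∂μ + τ * ∑ i, a i * ∫ z in A i, F z ∂μ := by
    intro μ F hF
    have e : ∀ z, k z * F z = F z + ∑ i, τ * a i * (A i).indicator F z := by
      intro z
      simp only [hk, add_mul, one_mul, Finset.sum_mul]
      congr 1
      refine Finset.sum_congr rfl fun i _ => ?_
      by_cases h : z ∈ A i <;> simp [h]
    simp only [e]
    have hi : ∀ i, Integrable (fun z => τ * a i * (A i).indicator F z) μ := fun i =>
      (hF.indicator (hA i)).const_mul _
    rw [integral_add hF (integrable_finsetSum _ fun i _ => hi i),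
      integral_finsetSum _ fun i _ => hi i, Finset.mul_sum]
    congr 1
    refine Finset.sum_congr rfl fun i _ => ?_
    rw [integral_const_mul, integral_indicator (hA i), mul_assoc]
  have hWf := (feasible_iff hdist hP).1 hW.1
  obtain ⟨V, hV, hVd⟩ := exists_isOptimal_reweight hb hdist hP hW hf hkm hk0 hkC
    (fun x hx => by
      have := hint (W x) 1 (integrable_const 1)
      simp only [Pi.one_apply, mul_one, integral_const, smul_eq_mul, Measure.real,
        measure_univ, Measure.restrict_apply MeasurableSet.univ, Set.univ_inter] at this
      rw [this]
      have := h1 x hx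
      simp only [Measure.real] at this
      rw [this]
      simp)
    (by
      rw [hint _ _ (hf.integrable_infoDensity (marginal_nonneg hP))]
      have := mul_nonpos_of_nonneg_of_nonpos hτ0.le h2
      linarith)
    (by
      have e : expect P (fun y => ∫ z, k z * (dist y.1 z).toReal ∂(W y.2 : Measure Z)) =
          expect P (fun y => ∫ z, (dist y.1 z).toReal ∂(W y.2 : Measure Z)) +
          τ * ∑ i, a i *
            expect P (fun y => ∫ z in A i, (dist y.1 z).toReal ∂(W y.2 : Measure Z)) := by
        have e' : ∀ y, P y * ∫ z, k z * (dist y.1 z).toReal ∂(W y.2 : Measure Z) =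
            P y * ∫ z, (dist y.1 z).toReal ∂(W y.2 : Measure Z) +
            ∑ i, τ * (a i * (P y * ∫ z in A i, (dist y.1 z).toReal ∂(W y.2 : Measure Z))) := by
          intro y
          rcases (hP y).eq_or_lt with h0 | h0
          · simp only [Pi.zero_apply] at h0
            simp [← h0]
          · rw [hint _ _ (integrable_toReal_of_lintegral_ne_top (hdist y.1).aemeasurable
              (hWf.1 y h0)), mul_add, Finset.mul_sum, Finset.mul_sum]
            congr 1
            exact Finset.sum_congr rfl fun i _ => by ring
        simp only [expect, e', Finset.sum_add_distrib]
        rw [Finset.sum_comm]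
        simp only [← Finset.mul_sum]
      rw [e]
      have := mul_nonpos_of_nonneg_of_nonpos hτ0.le h3
      linarith)
  refine ⟨V, hV, i₀, ?_⟩
  simp only [output, Measure.coe_finsetSum, Finset.sum_apply, Measure.smul_apply, smul_eq_mul]
  refine Finset.sum_eq_zero fun x _ => ?_
  rcases (marginal_nonneg hP x).eq_or_lt with h0 | h0
  · simp only [Pi.zero_apply] at h0
    simp [← h0]
  · rw [hVd x h0, withDensity_apply _ (hA i₀), setLIntegral_congr_fun (hA i₀)
      (g := fun _ => 0) fun z hz => by simp [hkA i₀ z hz, hτ1]]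
    simp

end

/-! ### Finiteness of the output support -/

section

variable [TopologicalSpace Z] [T2Space Z] [SecondCountableTopology Z] [BorelSpace Z]
variable {b : ℝ} {dist : S → Z → ℝ≥0∞} {P : S × X → ℝ}

/-- If all optimal kernels have the same output support, then this support is finite. -/
lemma IsOptimal.finite_support (hb : 0 < Real.log b) (hdist : ∀ s, Measurable (dist s))
    (hP : 0 ≤ P) {d : ℝ} {W : RepKernel X Z} (hW : IsOptimal b dist P d W)
    (hsupp : ∀ V, IsOptimal b dist P d V → (output P V).support = (output P W).support) :
    (output P W).support.Finite := by
  classical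
  by_contra hinf
  obtain ⟨ρ, f, -, hρ, hf, -⟩ := exists_isDensity W W
  -- There is one coordinate for the mass of each letter, one for the information and one for the
  -- distortion. One more support point than the dimension forces a linear dependence between
  -- disjoint neighbourhoods.
  obtain ⟨t, ht, hcard⟩ := Set.Infinite.exists_subset_card_eq hinf
    (Module.finrank ℝ ((X → ℝ) × ℝ × ℝ) + 1)
  obtain ⟨U, hU, hdisj⟩ := t.finite_toSet.t2_separation
  let v : t → (X → ℝ) × ℝ × ℝ := fun i =>
    (fun x => (W x : Measure Z).real (U i),
      ∫ z in U i, infoDensity (marginal P) (fun x => f x z) ∂ρ,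
      expect P (fun y => ∫ z in U i, (dist y.1 z).toReal ∂(W y.2 : Measure Z)))
  have hdep : ¬ LinearIndependent ℝ v := fun h => by
    have := h.fintype_card_le_finrank
    rw [Fintype.card_coe, hcard] at this
    omega
  obtain ⟨a', ha', i', hi'⟩ := Fintype.not_linearIndependent_iff.1 hdep
  -- All three sums vanish, so the relation may be negated to obtain a negative coefficient.
  obtain ⟨a, ha, hneg⟩ : ∃ a : t → ℝ, ∑ i, a i • v i = 0 ∧ ∃ i, a i < 0 := by
    rcases lt_or_gt_of_ne hi' with h | h
    · exact ⟨a', ha', i', h⟩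
    · exact ⟨-a', by simpa [-Finset.univ_eq_attach] using ha', i', by simpa using h⟩
  have ha1 := congrArg Prod.fst ha
  have ha2 := congrArg (fun p => p.2.1) ha
  have ha3 := congrArg (fun p => p.2.2) ha
  simp only [v, Prod.fst_sum, Prod.snd_sum, Prod.smul_fst, Prod.smul_snd, Prod.fst_zero,
    Prod.snd_zero, smul_eq_mul] at ha1 ha2 ha3
  obtain ⟨V, hV, i, hi⟩ := exists_isOptimal_output_eq_zero hb hdist hP hW (hf _)
    (A := fun i : t => U i) (fun i => (hU i).2.measurableSet)
    (fun i j hij => hdisj i.2 j.2 fun h => hij (Subtype.ext h)) hneg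
    (fun x _ => by simpa using congrFun ha1 x) ha2.le ha3.le
  have hmem : (i : Z) ∈ (output P V).support := by
    rw [hsupp V hV]
    exact ht i.2
  exact ((Measure.mem_support_iff_forall _).1 hmem _ ((hU i).2.mem_nhds (hU i).1)).ne' hi

end

/-! ### Finitely supported kernels -/

/-- Equality of the sums forces equality in each term of the log-sum inequality, hence
proportionality at every letter of positive mass. -/
lemma eq_of_le_infoDensity_add {q v w : X → ℝ} (hq : 0 ≤ q) (hv : 0 ≤ v) (hw : 0 ≤ w)
    (hmv : 0 < mix q v) (hmw : 0 < mix q w)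
    (h : infoDensity q v + infoDensity q w ≤ infoDensity q (v + w)) {x : X} (hx : 0 < q x) :
    v x / mix q v = w x / mix q w := by
  simp only [infoDensity, ← Finset.sum_add_distrib, ← mul_add, mix_add, Pi.add_apply] at h
  have hle : ∀ x ∈ Finset.univ, q x * ((v x + w x) * Real.log ((v x + w x) / (mix q v + mix q w))) ≤
      q x * (v x * Real.log (v x / mix q v) + w x * Real.log (w x / mix q w)) := fun x _ =>
    mul_le_mul_of_nonneg_left (log_sum_le (hv x) (hw x) hmv.le hmw.le
      (fun h => absurd h hmv.ne') (fun h => absurd h hmw.ne')) (hq x)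
  have heq := (Finset.sum_eq_sum_iff_of_le hle).1 (le_antisymm (Finset.sum_le_sum hle) h) x
    (Finset.mem_univ x)
  exact eq_of_le_log_sum (hv x) (hw x) hmv hmw (mul_left_cancel₀ hx.ne' heq).ge

/-- The measure with point masses `w z`, `z ∈ F`. -/
def pointSum (F : Finset Z) (w : Z → ℝ) : Measure Z :=
  ∑ z ∈ F, ENNReal.ofReal (w z) • Measure.dirac z

lemma withDensity_sum_dirac (F : Finset Z) {g : Z → ℝ} (hg : Measurable g) :
    (∑ z ∈ F, Measure.dirac z).withDensity (fun z => ENNReal.ofReal (g z)) = pointSum F g := by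
  ext A hA
  rw [withDensity_apply _ hA, ← lintegral_indicator hA, lintegral_finsetSum_measure, pointSum,
    Measure.coe_finsetSum, Finset.sum_apply]
  refine Finset.sum_congr rfl fun z _ => ?_
  rw [lintegral_dirac' _ (hg.ennreal_ofReal.indicator hA), Measure.smul_apply,
    Measure.dirac_apply' _ hA, smul_eq_mul]
  by_cases h : z ∈ A <;> simp [h]

section

variable [MeasurableSingletonClass Z]

lemma eq_pointSum {μ : Measure Z} [IsFiniteMeasure μ] {F : Finset Z} (h : μ (F : Set Z)ᶜ = 0) :
    μ = pointSum F fun z => μ.real {z} := by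
  have h1 : μ.restrict (F : Set Z) = μ := Measure.restrict_eq_self_of_ae_mem (by
    rw [ae_iff]; exact h)
  ext A hA
  rw [pointSum, Measure.coe_finsetSum, Finset.sum_apply]
  have h2 : μ A = μ (A ∩ F) := by
    conv_lhs => rw [← h1]
    rw [Measure.restrict_apply hA]
  have h3 : A ∩ (F : Set Z) = ⋃ z ∈ F, A ∩ {z} := by
    ext z; simp
  rw [h2, h3, measure_biUnion_finset]
  · refine Finset.sum_congr rfl fun z _ => ?_
    rw [Measure.smul_apply, Measure.dirac_apply' _ hA, smul_eq_mul, Measure.real,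
      ENNReal.ofReal_toReal (measure_ne_top _ _)]
    by_cases h : z ∈ A
    · rw [Set.inter_eq_right.2 (Set.singleton_subset_iff.2 h)]; simp [h]
    · rw [Set.inter_singleton_eq_empty.2 h]; simp [h]
  · intro z _ z' _ hz
    exact Set.disjoint_left.2 fun y hy hy' => hz (hy.2.symm.trans hy'.2)
  · exact fun z _ => hA.inter (measurableSet_singleton z)

lemma pointSum_real_singleton (F : Finset Z) {w : Z → ℝ} (hw : 0 ≤ w) {z : Z} (hz : z ∈ F) :
    (pointSum F w).real {z} = w z := by
  rw [pointSum, Measure.real, Measure.coe_finsetSum, Finset.sum_apply, Finset.sum_eq_single z]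
  · simp [ENNReal.toReal_ofReal (hw z)]
  · intro z' _ hz'
    simp [hz']
  · exact fun h => absurd hz h

lemma pointSum_univ (F : Finset Z) {w : Z → ℝ} (hw : 0 ≤ w) :
    pointSum F w Set.univ = ENNReal.ofReal (∑ z ∈ F, w z) := by
  rw [pointSum, Measure.coe_finsetSum, Finset.sum_apply, ENNReal.ofReal_sum_of_nonneg fun z _ => hw z]
  simp

lemma lintegral_pointSum (F : Finset Z) (w : Z → ℝ) (g : Z → ℝ≥0∞) :
    ∫⁻ z, g z ∂(pointSum F w) = ∑ z ∈ F, ENNReal.ofReal (w z) * g z := by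
  simp [pointSum]

lemma integral_sum_dirac (F : Finset Z) (g : Z → ℝ) :
    ∫ z, g z ∂(∑ z ∈ F, Measure.dirac z) = ∑ z ∈ F, g z := by
  rw [integral_finsetSum_measure fun z _ => integrable_dirac (by simp)]
  simp

/-- A density of a finitely supported kernel with respect to the counting measure. -/
lemma exists_isDensity_sum_dirac {q : X → ℝ} {W : RepKernel X Z} {F : Finset Z} {w : X → Z → ℝ}
    (hw : ∀ x, 0 ≤ w x) (hW : ∀ x, 0 < q x → (W x : Measure Z) = pointSum F (w x)) :
    ∃ f : X → Z → ℝ, IsDensity q W (∑ z ∈ F, Measure.dirac z) f ∧ ∀ x, ∀ z ∈ F, f x z = w x z := by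
  classical
  -- No measurability of `w x` is available; the finite combination of indicators agrees with it on
  -- `F` and is measurable.
  set f : X → Z → ℝ := fun x z => ∑ z' ∈ F, w x z' * Set.indicator {z'} 1 z with hf
  have hfw : ∀ x, ∀ z ∈ F, f x z = w x z := by
    intro x z hz
    simp only [hf]
    rw [Finset.sum_eq_single z]
    · simp
    · intro z' _ hz'
      simp [hz'.symm]
    · exact fun h => absurd hz h
  have hm : ∀ x, Measurable (f x) := fun x => Finset.measurable_sum _ fun z _ =>
    (measurable_one.indicator (measurableSet_singleton z)).const_mul _
  have hind : ∀ z z' : Z, 0 ≤ Set.indicator {z'} (1 : Z → ℝ) z := fun z z' =>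
    Set.indicator_nonneg (fun _ _ => zero_le_one) _
  have hind1 : ∀ z z' : Z, Set.indicator {z'} (1 : Z → ℝ) z ≤ 1 := fun z z' =>
    Set.indicator_apply_le' (fun _ => le_rfl) fun _ => zero_le_one
  refine ⟨f, ⟨hm, fun z x => Finset.sum_nonneg fun z' _ => mul_nonneg (hw x z') (hind z z'), ?_,
    fun x hx => ?_⟩, hfw⟩
  · refine ⟨∑ x, ∑ z ∈ F, w x z, fun x z => ?_⟩
    refine (Finset.sum_le_sum fun z' _ => mul_le_of_le_one_right (hw x z') (hind1 z z')).trans ?_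
    exact Finset.single_le_sum (f := fun x => ∑ z ∈ F, w x z)
      (fun x _ => Finset.sum_nonneg fun z _ => hw x z) (Finset.mem_univ x)
  · rw [withDensity_sum_dirac F (hm x), hW x hx]
    exact Finset.sum_congr rfl fun z hz => by rw [hfw x z hz]

variable {b : ℝ} {dist : S → Z → ℝ≥0∞} {P : S × X → ℝ} {W : RepKernel X Z} {F : Finset Z}
  {w : X → Z → ℝ}

lemma mutualInfo_eq_sum (hP : 0 ≤ P) (hw : ∀ x, 0 ≤ w x)
    (hW : ∀ x, 0 < marginal P x → (W x : Measure Z) = pointSum F (w x)) :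
    mutualInfo b P W = (∑ z ∈ F, infoDensity (marginal P) fun x => w x z) / Real.log b := by
  obtain ⟨f, hf, hfw⟩ := exists_isDensity_sum_dirac hw hW
  rw [hf.mutualInfo_eq hP, integral_sum_dirac]
  congr 1
  exact Finset.sum_congr rfl fun z hz => by simp only [hfw _ z hz]

lemma relEntropy_eq_sum (hP : 0 ≤ P) (hw : ∀ x, 0 ≤ w x)
    (hW : ∀ x, 0 < marginal P x → (W x : Measure Z) = pointSum F (w x)) {x : X}
    (hx : 0 < marginal P x) :
    relEntropy b (W x : Measure Z) (output P W) =
      (∑ z ∈ F, w x z * Real.log (w x z / mix (marginal P) fun x => w x z)) / Real.log b := by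
  obtain ⟨f, hf, hfw⟩ := exists_isDensity_sum_dirac hw hW
  rw [hf.relEntropy_eq hP hx, integral_sum_dirac]
  congr 1
  exact Finset.sum_congr rfl fun z hz => by simp only [hfw _ z hz]

lemma condDistortion_eq_sum {s : S} {x : X} (hW : (W x : Measure Z) = pointSum F (w x)) :
    condDistortion dist W s x = ∑ z ∈ F, ENNReal.ofReal (w x z) * dist s z := by
  rw [condDistortion, hW, lintegral_pointSum]

lemma sum_eq_one {x : X} (hw : 0 ≤ w x) (hW : (W x : Measure Z) = pointSum F (w x)) :
    ∑ z ∈ F, w x z = 1 := by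
  have h : (W x : Measure Z) Set.univ = 1 := measure_univ
  rw [hW, pointSum_univ F hw, ENNReal.ofReal_eq_one] at h
  exact h

end

lemma output_apply_eq_zero {P : S × X → ℝ} {W : RepKernel X Z} {A : Set Z}
    (h : output P W A = 0) {x : X} (hx : 0 < marginal P x) : (W x : Measure Z) A = 0 := by
  simp only [output, Measure.coe_finsetSum, Finset.sum_apply, Measure.smul_apply, smul_eq_mul] at h
  have := (Finset.sum_eq_zero_iff.1 h) x (Finset.mem_univ x)
  exact (mul_eq_zero.1 this).resolve_left (by simpa using hx)

/-! ### Uniqueness of the optimal kernel -/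

section

variable [TopologicalSpace Z] [T2Space Z] [SecondCountableTopology Z] [BorelSpace Z]
variable {b : ℝ} {dist : S → Z → ℝ≥0∞} {P : S × X → ℝ}

/-- The other support points form a closed set, so `z` has a neighbourhood meeting the support only
in `z`, and the complement of the support is null. -/
lemma measure_singleton_pos_of_finite_support {μ : Measure Z} (hfin : μ.support.Finite) {z : Z}
    (hz : z ∈ μ.support) : 0 < μ {z} := by
  have hopen : IsOpen (μ.support \ {z})ᶜ := (hfin.subset Set.sdiff_subset).isClosed.isOpen_compl
  have hpos := (Measure.mem_support_iff_forall z).1 hz _ (hopen.mem_nhds (by simp))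
  refine hpos.trans_le ((measure_mono (t := {z} ∪ μ.supportᶜ) fun y hy => ?_).trans
    ((measure_union_le _ _).trans (by simp)))
  by_cases h : y = z
  · exact Or.inl h
  · exact Or.inr fun h' => hy ⟨h', h⟩

lemma kernel_eq_pointSum {W : RepKernel X Z} {F : Finset Z}
    (hF : (output P W).support = F) {x : X} (hx : 0 < marginal P x) :
    (W x : Measure Z) = pointSum F fun z => (W x : Measure Z).real {z} :=
  eq_pointSum (output_apply_eq_zero (by rw [← hF]; simp) hx)

lemma mix_pos_of_mem_support (hP : 0 ≤ P) {W : RepKernel X Z} {F : Finset Z}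
    (hF : (output P W).support = F) {z : Z} (hz : z ∈ F) :
    0 < mix (marginal P) fun x => (W x : Measure Z).real {z} := by
  have hpos : 0 < output P W {z} := measure_singleton_pos_of_finite_support
    (by rw [hF]; exact F.finite_toSet) (by rw [hF]; exact hz)
  have hq := marginal_nonneg hP
  have hw : 0 ≤ fun x => (W x : Measure Z).real {z} := fun x => measureReal_nonneg
  refine lt_of_le_of_ne (mix_nonneg hq hw) fun h => hpos.ne' ?_
  simp only [output, Measure.coe_finsetSum, Finset.sum_apply, Measure.smul_apply, smul_eq_mul]
  refine Finset.sum_eq_zero fun x _ => ?_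
  rcases (hq x).eq_or_lt with h0 | h0
  · simp only [Pi.zero_apply] at h0
    simp [← h0]
  · have := eq_zero_of_mix_eq_zero hq hw h0 h.symm
    rw [measureReal_eq_zero_iff] at this
    rw [this, mul_zero]

/-- If all optimal kernels have the same output support, then the optimal kernel is unique. -/
lemma IsOptimal.unique (hb : 0 < Real.log b) (hdist : ∀ s, Measurable (dist s))
    (hP : 0 ≤ P) {d : ℝ} {F : Finset Z}
    (hF : ∀ V, IsOptimal b dist P d V → (output P V).support = F)
    {W V : RepKernel X Z} (hW : IsOptimal b dist P d W) (hV : IsOptimal b dist P d V)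
    {x : X} (hx : 0 < marginal P x) {z : Z} (hz : z ∈ F) :
    (W x : Measure Z).real {z} = (V x : Measure Z).real {z} := by
  classical
  have hq := marginal_nonneg hP
  set w : X → Z → ℝ := fun x z => (W x : Measure Z).real {z} with hw
  set v : X → Z → ℝ := fun x z => (V x : Measure Z).real {z} with hv
  have hw0 : ∀ x, 0 ≤ w x := fun x z => measureReal_nonneg
  have hv0 : ∀ x, 0 ≤ v x := fun x z => measureReal_nonneg
  have hWw : ∀ x, 0 < marginal P x → (W x : Measure Z) = pointSum F (w x) :=
    fun x hx => kernel_eq_pointSum (hF W hW) hx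
  have hVv : ∀ x, 0 < marginal P x → (V x : Measure Z) = pointSum F (v x) :=
    fun x hx => kernel_eq_pointSum (hF V hV) hx
  have hmw : ∀ z ∈ F, 0 < mix (marginal P) fun x => w x z :=
    fun z hz => mix_pos_of_mem_support hP (hF W hW) hz
  have hmv : ∀ z ∈ F, 0 < mix (marginal P) fun x => v x z :=
    fun z hz => mix_pos_of_mem_support hP (hF V hV) hz
  have hIw := mutualInfo_eq_sum (b := b) hP hw0 hWw
  have hIv := mutualInfo_eq_sum (b := b) hP hv0 hVv
  rw [hW.2] at hIw
  rw [hV.2] at hIv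
  -- equality in the convexity inequality at the midpoint
  have hratio : ∀ z ∈ F, ∀ x, 0 < marginal P x →
      w x z / mix (marginal P) (fun x => w x z) = v x z / mix (marginal P) (fun x => v x z) := by
    obtain ⟨U, hU, hUd, -⟩ := exists_timeSharing (b := b) (dist := dist) hb hP W V
      (t := 1 / 2) (u := 1 / 2) (by norm_num) (by norm_num) (by norm_num)
    have hUf := hW.1.timeSharing hdist hP (by norm_num) (by norm_num) hV.1 hUd
    rw [← add_mul, add_halves, one_mul] at hUf
    have hUu : ∀ x, 0 < marginal P x →
        (U x : Measure Z) = pointSum F ((1 / 2 : ℝ) • (w x + v x)) := by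
      intro x hx
      rw [hU x, hWw x hx, hVv x hx]
      simp only [pointSum, Finset.smul_sum, ← Finset.sum_add_distrib, smul_smul, ← add_smul,
        Pi.smul_apply, Pi.add_apply, smul_eq_mul, mul_add]
      refine Finset.sum_congr rfl fun z _ => ?_
      rw [ENNReal.ofReal_add (mul_nonneg (by norm_num) (hw0 x z))
        (mul_nonneg (by norm_num) (hv0 x z)), ENNReal.ofReal_mul (by norm_num),
        ENNReal.ofReal_mul (by norm_num)]
    have hIu := mutualInfo_eq_sum (b := b) hP
      (fun x => smul_nonneg (by norm_num) (add_nonneg (hw0 x) (hv0 x))) hUu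
    have hge := rate_le (b := b) hb hP hUf
    have hterm : ∀ z ∈ F, infoDensity (marginal P) (fun x => ((1 / 2 : ℝ) • (w x + v x)) z) ≤
        1 / 2 * (infoDensity (marginal P) (fun x => w x z) +
          infoDensity (marginal P) fun x => v x z) := fun z _ => by
      have h1 := infoDensity_smul (marginal P) ((fun x => w x z) + fun x => v x z)
        (show (0 : ℝ) ≤ 1 / 2 by norm_num)
      have h2 := infoDensity_add_le (v := fun x => w x z) (w := fun x => v x z) hq
        (fun x => hw0 x z) (fun x => hv0 x z)
      exact h1.trans_le (mul_le_mul_of_nonneg_left h2 (by norm_num))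
    have hsum : ∑ z ∈ F, 1 / 2 * (infoDensity (marginal P) (fun x => w x z) +
        infoDensity (marginal P) fun x => v x z) ≤
        ∑ z ∈ F, infoDensity (marginal P) (fun x => ((1 / 2 : ℝ) • (w x + v x)) z) := by
      rw [hIu, le_div_iff₀ hb] at hge
      rw [eq_div_iff hb.ne'] at hIw hIv
      rw [← Finset.mul_sum, Finset.sum_add_distrib, ← hIw, ← hIv]
      linarith
    intro z hz x hx
    have heq := (Finset.sum_eq_sum_iff_of_le hterm).1
      (le_antisymm (Finset.sum_le_sum hterm) hsum) z hz
    have h1 := infoDensity_smul (marginal P) ((fun x => w x z) + fun x => v x z)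
      (show (0 : ℝ) ≤ 1 / 2 by norm_num)
    refine eq_of_le_infoDensity_add (v := fun x => w x z) (w := fun x => v x z) hq
      (fun x => hw0 x z) (fun x => hv0 x z) (hmw z hz) (hmv z hz) ?_ hx
    have h2 := h1.symm.trans heq
    linarith
  set r : Z → ℝ := fun z =>
    mix (marginal P) (fun x => v x z) / mix (marginal P) (fun x => w x z) with hr
  have hvr : ∀ z ∈ F, ∀ x, 0 < marginal P x → v x z = r z * w x z := by
    intro z hz x hx
    have := hratio z hz x hx
    rw [div_eq_div_iff (hmw z hz).ne' (hmv z hz).ne'] at this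
    simp only [hr]
    rw [div_mul_eq_mul_div, eq_div_iff (hmw z hz).ne']
    linarith
  -- By proportionality and homogeneity the information density scales by `r z`. Hence the direction
  -- `r - 1` changes the information by the difference of two optimal values, which is zero.
  have hinfo : ∀ z ∈ F, infoDensity (marginal P) (fun x => v x z) =
      r z * infoDensity (marginal P) fun x => w x z := by
    intro z hz
    rw [← infoDensity_smul _ _ (div_nonneg (hmv z hz).le (hmw z hz).le)]
    have hmix : mix (marginal P) (r z • fun x => w x z) = mix (marginal P) fun x => v x z := by
      rw [mix_smul]; exact div_mul_cancel₀ _ (hmw z hz).ne'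
    change _ = infoDensity (marginal P) (r z • fun x => w x z)
    simp only [infoDensity, hmix]
    refine Finset.sum_congr rfl fun x _ => ?_
    rcases (hq x).eq_or_lt with h0 | h0
    · simp only [Pi.zero_apply] at h0
      simp [← h0]
    · rw [hvr z hz x h0]; rfl
  obtain ⟨f, hf, hfw⟩ := exists_isDensity_sum_dirac hw0 hWw
  by_contra hne
  have hrz : r z - 1 ≠ 0 := fun h => hne (by
    have := hvr z hz x hx
    rw [show r z = 1 by linarith, one_mul] at this
    exact this.symm)
  set D : Z → ℝ := fun z =>
    expect P fun y => ∫ z' in {z}, (dist y.1 z').toReal ∂(W y.2 : Measure Z) with hD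
  -- The kernel masses and the information do not change along `r - 1`, so its sign is free and is
  -- chosen so that the distortion does not increase.
  obtain ⟨σ, hσ0, hσ⟩ : ∃ σ : ℝ, σ ≠ 0 ∧ σ * ∑ z ∈ F, (r z - 1) * D z ≤ 0 := by
    rcases le_total (∑ z ∈ F, (r z - 1) * D z) 0 with h | h
    · exact ⟨1, one_ne_zero, by linarith⟩
    · exact ⟨-1, by norm_num, by linarith⟩
  have hx0 : ∀ x, 0 < marginal P x → ∑ z ∈ F, σ * (r z - 1) * w x z = 0 := by
    intro x hx
    have h1 := sum_eq_one (hw0 x) (hWw x hx)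
    have h2 := sum_eq_one (hv0 x) (hVv x hx)
    have h3 : ∀ z ∈ F, σ * (r z - 1) * w x z = σ * (v x z - w x z) := fun z hz => by
      rw [hvr z hz x hx]; ring
    rw [Finset.sum_congr rfl h3, ← Finset.mul_sum, Finset.sum_sub_distrib, h1, h2]
    simp
  -- The direction has mean zero under strictly positive output masses. If it were nonnegative it
  -- would vanish identically, against `hrz`.
  have hneg : ∃ i : F, σ * (r i - 1) < 0 := by
    by_contra hcon
    push Not at hcon
    have h0 : ∑ z ∈ F, σ * (r z - 1) * mix (marginal P) (fun x => w x z) = 0 := by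
      simp only [mix, Finset.mul_sum]
      rw [Finset.sum_comm]
      refine Finset.sum_eq_zero fun x _ => ?_
      rcases (hq x).eq_or_lt with h0 | h0
      · simp only [Pi.zero_apply] at h0
        simp [← h0]
      · rw [← mul_zero (marginal P x), ← hx0 x h0, Finset.mul_sum]
        exact Finset.sum_congr rfl fun z _ => by ring
    have h1 := (Finset.sum_eq_zero_iff_of_nonneg fun z hz =>
      mul_nonneg (hcon ⟨z, hz⟩) (hmw z hz).le).1 h0 z hz
    exact mul_ne_zero (mul_ne_zero hσ0 hrz) (hmw z hz).ne' h1
  obtain ⟨V', hV', i, hi⟩ := exists_isOptimal_output_eq_zero hb hdist hP hW hf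
    (A := fun i : F => ({(i : Z)} : Set Z)) (fun i => measurableSet_singleton _)
    (fun i j hij => Set.disjoint_singleton.2 fun h => hij (Subtype.ext h)) hneg
    (fun x hx => by
      rw [← hx0 x hx]
      exact Finset.sum_coe_sort F fun z => σ * (r z - 1) * w x z)
    (by
      have h1 : ∀ i : F, ∫ z in {(i : Z)}, infoDensity (marginal P) (fun x => f x z)
          ∂(∑ z ∈ F, Measure.dirac z) = infoDensity (marginal P) fun x => w x i := by
        intro i
        have h2 : (∑ z ∈ F, Measure.dirac z : Measure Z).real {(i : Z)} = 1 := by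
          have := pointSum_real_singleton F (w := 1) (fun _ => zero_le_one) i.2
          simpa [pointSum] using this
        rw [integral_singleton, h2, one_smul]
        simp only [hfw _ _ i.2]
      simp only [h1]
      rw [Finset.sum_coe_sort F fun z => σ * (r z - 1) * infoDensity (marginal P) fun x => w x z]
      have h3 : ∀ z ∈ F, σ * (r z - 1) * infoDensity (marginal P) (fun x => w x z) =
          σ * (infoDensity (marginal P) (fun x => v x z) -
            infoDensity (marginal P) fun x => w x z) := fun z hz => by
        rw [hinfo z hz]; ring
      rw [Finset.sum_congr rfl h3, ← Finset.mul_sum, Finset.sum_sub_distrib]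
      rw [eq_div_iff hb.ne'] at hIw hIv
      rw [← hIw, ← hIv, sub_self, mul_zero])
    (by
      refine le_of_eq_of_le ?_ hσ
      rw [Finset.mul_sum, ← Finset.sum_coe_sort F]
      exact Finset.sum_congr rfl fun z _ => mul_assoc _ _ _)
  have hpos : 0 < output P V' {(i : Z)} := measure_singleton_pos_of_finite_support
    (by rw [hF V' hV']; exact F.finite_toSet) (by rw [hF V' hV']; exact i.2)
  exact hpos.ne' hi

end

/-! ### Convergence of rates, slopes and optimal kernels -/

open Filter

/-- `Q` converges to `P` together with all ratios of masses. -/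
structure TendstoComparably {α : Type*} (l : Filter α) (Q : α → S × X → ℝ) (P : S × X → ℝ)
    (c : α → ℝ) : Prop where
  tendsto : Tendsto Q l (𝓝 P)
  tendsto_const : Tendsto c l (𝓝 1)
  nonneg : ∀ᶠ a in l, 0 ≤ Q a
  le_mul : ∀ᶠ a in l, ∀ y, P y ≤ c a * Q a y
  ge_mul : ∀ᶠ a in l, ∀ y, Q a y ≤ c a * P y

section

variable {α : Type*} {l : Filter α} {Q : α → S × X → ℝ} {P : S × X → ℝ} {c : α → ℝ}
  {b : ℝ} {dist : S → Z → ℝ≥0∞}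

lemma TendstoComparably.apply (h : TendstoComparably l Q P c) (y : S × X) :
    Tendsto (fun a => Q a y) l (𝓝 (P y)) := tendsto_pi_nhds.1 h.tendsto y

lemma TendstoComparably.mass (h : TendstoComparably l Q P c) :
    Tendsto (fun a => NoisyRD.mass (Q a)) l (𝓝 (NoisyRD.mass P)) :=
  tendsto_finsetSum _ fun y _ => h.apply y

lemma TendstoComparably.marginal (h : TendstoComparably l Q P c) (x : X) :
    Tendsto (fun a => NoisyRD.marginal (Q a) x) l (𝓝 (NoisyRD.marginal P x)) :=
  tendsto_finsetSum _ fun s _ => h.apply (s, x)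

lemma TendstoComparably.pos_iff (h : TendstoComparably l Q P c) :
    ∀ᶠ a in l, ∀ y, 0 < Q a y ↔ 0 < P y := by
  filter_upwards [h.tendsto_const.eventually (lt_mem_nhds one_pos), h.le_mul, h.ge_mul]
    with a hc h1 h2 y
  exact ⟨fun hy => pos_of_mul_pos_right (hy.trans_le (h2 y)) hc.le,
    fun hy => pos_of_mul_pos_right (hy.trans_le (h1 y)) hc.le⟩

lemma TendstoComparably.marginal_pos (h : TendstoComparably l Q P c) :
    ∀ᶠ a in l, ∀ x, 0 < NoisyRD.marginal (Q a) x ↔ 0 < NoisyRD.marginal P x := by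
  filter_upwards [h.tendsto_const.eventually (lt_mem_nhds one_pos), h.le_mul, h.ge_mul]
    with a hc h1 h2 x
  exact ⟨fun hy => pos_of_mul_pos_right (hy.trans_le (marginal_le_mul h2 x)) hc.le,
    fun hy => pos_of_mul_pos_right (hy.trans_le (marginal_le_mul h1 x)) hc.le⟩

/-- Feasibility below `d` is stable. -/
lemma TendstoComparably.eventually_feasible (h : TendstoComparably l Q P c)
    (hdist : ∀ s, Measurable (dist s)) (hP : 0 ≤ P) (hm : NoisyRD.mass P = 1) {δ ε : ℝ}
    (hδε : δ < ε) {V : RepKernel X Z} (hV : Feasible dist P δ V) :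
    ∀ᶠ a in l, Feasible dist (Q a) ε V := by
  have h1 : Tendsto (fun a => c a * (δ * NoisyRD.mass P)) l (𝓝 (1 * (δ * 1))) := by
    rw [hm]; exact h.tendsto_const.mul_const _
  have h2 : Tendsto (fun a => ε * NoisyRD.mass (Q a)) l (𝓝 (ε * 1)) := by
    have := h.mass
    rw [hm] at this
    exact this.const_mul _
  filter_upwards [h.nonneg, h.tendsto_const.eventually (lt_mem_nhds one_pos), h.ge_mul,
    h1.eventually_lt h2 (by linarith)] with a hQ hc hle hlt
  exact hV.of_le_mul hdist hQ hP hc.le hle hlt.le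

/-- Comparability bounds each rate by a multiple of the other at a slightly shifted level. The
multiples tend to one, and the shifts vanish in the limit because a convex function is continuous in
the interior of its domain. -/
lemma TendstoComparably.rate (h : TendstoComparably l Q P c) (hb : 0 < Real.log b)
    (hdist : ∀ s, Measurable (dist s)) (hP : 0 ≤ P) (hm : NoisyRD.mass P = 1) {δ₀ δ : ℝ}
    (hδ : δ₀ < δ) {V : RepKernel X Z} (hV : Feasible dist P δ₀ V) :
    Tendsto (fun a => NoisyRD.rate b dist (Q a) δ) l (𝓝 (NoisyRD.rate b dist P δ)) := by
  have hfeas : ∀ {ε}, δ₀ ≤ ε → ∃ W : RepKernel X Z, Feasible dist P ε W :=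
    fun hε => ⟨V, hV.mono hP hε⟩
  have hcont : ContinuousAt (NoisyRD.rate b dist P) δ :=
    (((convexOn_rate hb hdist hP).subset (fun ε hε => hfeas (le_of_lt hε))
      (convex_Ioi δ₀)).continuousOn isOpen_Ioi).continuousAt (Ioi_mem_nhds hδ)
  have hc := h.tendsto_const
  have hmQ := h.mass
  rw [hm] at hmQ
  have t1 : Tendsto (fun a => δ * NoisyRD.mass (Q a) / c a) l (𝓝 δ) := by
    have := (hmQ.const_mul δ).div hc one_ne_zero
    rwa [mul_one, div_one] at this
  have t2 : Tendsto (fun a => c a * (δ * NoisyRD.mass (Q a))) l (𝓝 δ) := by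
    have := hc.mul (hmQ.const_mul δ)
    simpa using this
  have t3 : Tendsto (fun a => (c a * (NoisyRD.mass (Q a) * (NoisyRD.mass (Q a) - 1)) +
      NoisyRD.mass (Q a) * (1 - NoisyRD.mass P)) / Real.log b) l (𝓝 0) := by
    have := ((hc.mul (hmQ.mul (hmQ.sub_const 1))).add (hmQ.mul_const (1 - NoisyRD.mass P))).div_const
      (Real.log b)
    simpa [hm] using this
  have t4 : Tendsto (fun a => (c a * (NoisyRD.mass P * (NoisyRD.mass P - 1)) +
      NoisyRD.mass P * (1 - NoisyRD.mass (Q a))) / Real.log b) l (𝓝 0) := by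
    have := (((hmQ.const_sub 1).const_mul 1).div_const (Real.log b))
    simpa [hm] using this
  have upper : Tendsto (fun a => c a * NoisyRD.rate b dist P (δ * NoisyRD.mass (Q a) / c a) +
      (c a * (NoisyRD.mass P * (NoisyRD.mass P - 1)) +
      NoisyRD.mass P * (1 - NoisyRD.mass (Q a))) / Real.log b) l
      (𝓝 (NoisyRD.rate b dist P δ)) := by
    simpa using (hc.mul (hcont.tendsto.comp t1)).add t4
  have lower : Tendsto (fun a => (NoisyRD.rate b dist P (c a * (δ * NoisyRD.mass (Q a))) -
      (c a * (NoisyRD.mass (Q a) * (NoisyRD.mass (Q a) - 1)) +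
      NoisyRD.mass (Q a) * (1 - NoisyRD.mass P)) / Real.log b) / c a) l
      (𝓝 (NoisyRD.rate b dist P δ)) := by
    have := ((hcont.tendsto.comp t2).sub t3).div hc one_ne_zero
    rwa [sub_zero, div_one] at this
  refine tendsto_of_tendsto_of_tendsto_of_le_of_le' lower upper ?_ ?_
  · filter_upwards [h.nonneg, hc.eventually (lt_mem_nhds one_pos), h.le_mul,
      h.eventually_feasible hdist hP hm hδ hV] with a hQ hca hle hfe
    have := rate_le_mul (b := b) hb hdist hP hQ hca hle (δ := δ)
      (δ' := c a * (δ * NoisyRD.mass (Q a))) (by rw [hm, mul_one]) ⟨V, hfe⟩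
    rw [div_le_iff₀ hca]
    linarith
  · filter_upwards [h.nonneg, hc.eventually (lt_mem_nhds one_pos), h.ge_mul,
      t1.eventually (lt_mem_nhds hδ)] with a hQ hca hle hlt
    exact rate_le_mul (b := b) hb hdist hQ hP hca hle
      (by rw [hm, mul_one, mul_div_cancel₀ _ hca.ne']) (hfeas hlt.le)

/-- Subgradients of pointwise convergent functions converge at a point of differentiability of the
limit. -/
lemma tendsto_of_hasDerivAt_of_tangent {F : α → ℝ → ℝ} {f : ℝ → ℝ} {m : α → ℝ} {m₀ d : ℝ}
    (hf : HasDerivAt f m₀ d) (hpt : ∀ᶠ δ in 𝓝 d, Tendsto (fun a => F a δ) l (𝓝 (f δ)))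
    (htan : ∀ᶠ δ in 𝓝 d, ∀ᶠ a in l, F a d + m a * (δ - d) ≤ F a δ) :
    Tendsto m l (𝓝 m₀) := by
  have hd := hpt.self_of_nhds
  have hs := hasDerivAt_iff_tendsto_slope.1 hf
  have hleft : Tendsto (_root_.slope f d) (𝓝[<] d) (𝓝 m₀) :=
    hs.mono_left (nhdsWithin_mono _ fun x hx => ne_of_lt hx)
  have hright : Tendsto (_root_.slope f d) (𝓝[>] d) (𝓝 m₀) :=
    hs.mono_left (nhdsWithin_mono _ fun x hx => ne_of_gt hx)
  refine tendsto_order.2 ⟨fun p hp => ?_, fun p hp => ?_⟩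
  -- A point left of `d` is taken whose secant slope for the limit exceeds `p`. The same secant for
  -- `F a` eventually exceeds `p` too, and it is a lower bound for the subgradient.
  · obtain ⟨δ, h1, h2, h3, h4⟩ := ((hleft.eventually (lt_mem_nhds hp)).and
      (eventually_mem_nhdsWithin.and ((hpt.filter_mono nhdsWithin_le_nhds).and
        (htan.filter_mono nhdsWithin_le_nhds)))).exists
    have h2' : δ - d < 0 := sub_neg.2 h2
    have h5 : Tendsto (fun a => (F a δ - F a d) / (δ - d)) l (𝓝 (_root_.slope f d δ)) := by
      rw [slope_def_field]
      exact (h3.sub hd).div_const _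
    filter_upwards [h4, h5.eventually (lt_mem_nhds h1)] with a ha hb
    refine hb.trans_le ?_
    rw [div_le_iff_of_neg h2']
    linarith
  · obtain ⟨δ, h1, h2, h3, h4⟩ := ((hright.eventually (gt_mem_nhds hp)).and
      (eventually_mem_nhdsWithin.and ((hpt.filter_mono nhdsWithin_le_nhds).and
        (htan.filter_mono nhdsWithin_le_nhds)))).exists
    have h2' : 0 < δ - d := sub_pos.2 h2
    have h5 : Tendsto (fun a => (F a δ - F a d) / (δ - d)) l (𝓝 (_root_.slope f d δ)) := by
      rw [slope_def_field]
      exact (h3.sub hd).div_const _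
    filter_upwards [h4, h5.eventually (gt_mem_nhds h1)] with a ha hb
    refine lt_of_le_of_lt ?_ hb
    rw [le_div_iff₀ h2']
    linarith

lemma TendstoComparably.slope (h : TendstoComparably l Q P c) (hb : 0 < Real.log b)
    (hdist : ∀ s, Measurable (dist s)) (hP : 0 ≤ P) (hm : NoisyRD.mass P = 1) {d : ℝ}
    (hmin : ∃ δ < d, ∃ V : RepKernel X Z, Feasible dist P δ V)
    (hd : DifferentiableAt ℝ (fun δ => NoisyRD.rate b dist P δ) d)
    (hdQ : ∀ᶠ a in l, DifferentiableAt ℝ (fun δ => NoisyRD.rate b dist (Q a) δ) d) :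
    Tendsto (fun a => NoisyRD.slope b dist (Q a) d) l (𝓝 (NoisyRD.slope b dist P d)) := by
  obtain ⟨δ₀, hδ₀, V, hV⟩ := hmin
  have hda := hd.hasDerivAt
  have key : Tendsto (fun a => -NoisyRD.slope b dist (Q a) d) l
      (𝓝 (deriv (fun δ => NoisyRD.rate b dist P δ) d)) := by
    refine tendsto_of_hasDerivAt_of_tangent (F := fun a δ => NoisyRD.rate b dist (Q a) δ) hda ?_ ?_
    · filter_upwards [lt_mem_nhds hδ₀] with δ hδ using h.rate hb hdist hP hm hδ hV
    · filter_upwards [lt_mem_nhds hδ₀] with δ hδ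
      obtain ⟨δ₁, h1, h2⟩ := exists_between (lt_min hδ₀ hδ)
      filter_upwards [hdQ, h.nonneg, h.eventually_feasible hdist hP hm h1 hV] with a ha hQ hf
      have := (slope_nonneg_and_tangent hb hdist hQ ⟨δ₁, h2.trans_le (min_le_left _ _), V, hf⟩ ha).2
        δ ⟨V, hf.mono hQ (h2.le.trans (min_le_right _ _))⟩
      linarith
  simpa [NoisyRD.slope] using key.neg

/-- In this form only `t * log t` occurs, which is continuous up to `t = 0`, so limits may have
vanishing masses. -/
lemma infoDensity_eq {q v : X → ℝ} (hq : 0 ≤ q) (hv : 0 ≤ v) :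
    infoDensity q v = ∑ x, q x * (v x * Real.log (v x)) - mix q v * Real.log (mix q v) := by
  conv_rhs => rw [mix, Finset.sum_mul, ← Finset.sum_sub_distrib]
  refine Finset.sum_congr rfl fun x _ => ?_
  rcases (hq x).eq_or_lt with h0 | h0
  · simp only [Pi.zero_apply] at h0
    simp [← h0]
  rcases eq_or_ne (v x) 0 with h1 | h1
  · simp [h1]
  rw [Real.log_div h1 fun h => h1 (eq_zero_of_mix_eq_zero hq hv h0 h), mix]
  ring

lemma tendsto_mix {q v : α → X → ℝ} {q₀ v₀ : X → ℝ}
    (hq : ∀ x, Tendsto (fun a => q a x) l (𝓝 (q₀ x)))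
    (hv : ∀ x, 0 < q₀ x → Tendsto (fun a => v a x) l (𝓝 (v₀ x)))
    (hq0 : 0 ≤ q₀) (hqv : ∀ᶠ a in l, ∀ x, q₀ x = 0 → q a x = 0) :
    Tendsto (fun a => mix (q a) (v a)) l (𝓝 (mix q₀ v₀)) := by
  refine tendsto_finsetSum _ fun x _ => ?_
  rcases (hq0 x).eq_or_lt with h0 | h0
  · simp only [Pi.zero_apply] at h0
    rw [← h0, zero_mul]
    refine tendsto_const_nhds.congr' ?_
    filter_upwards [hqv] with a ha
    rw [ha x h0.symm, zero_mul]
  · exact (hq x).mul (hv x h0)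

lemma toReal_condDistortion_eq_sum [MeasurableSingletonClass Z] {W : RepKernel X Z} {F : Finset Z}
    {w : X → Z → ℝ} {s : S} {x : X} (hw : 0 ≤ w x) (hW : (W x : Measure Z) = pointSum F (w x))
    (h : condDistortion dist W s x ≠ ∞) :
    (condDistortion dist W s x).toReal = ∑ z ∈ F, w x z * (dist s z).toReal := by
  rw [condDistortion_eq_sum hW] at h ⊢
  rw [ENNReal.toReal_sum (ENNReal.sum_ne_top.1 h)]
  refine Finset.sum_congr rfl fun z _ => ?_
  rw [ENNReal.toReal_mul, ENNReal.toReal_ofReal (hw z)]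

variable [TopologicalSpace Z] [T2Space Z] [SecondCountableTopology Z] [BorelSpace Z]

/-- Optimal kernels converge to the unique optimal kernel of the limit. -/
lemma TendstoComparably.kernel (h : TendstoComparably l Q P c) (hb : 0 < Real.log b)
    (hdist : ∀ s, Measurable (dist s)) (hP : 0 ≤ P) {d : ℝ} {F : Finset Z}
    (hF : ∀ V, IsOptimal b dist P d V → (output P V).support = F)
    {W : RepKernel X Z} (hW : IsOptimal b dist P d W) {V : α → RepKernel X Z}
    (hV : ∀ᶠ a in l, IsOptimal b dist (Q a) d (V a) ∧ (output (Q a) (V a)).support = F)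
    (hrate : Tendsto (fun a => NoisyRD.rate b dist (Q a) d) l (𝓝 (NoisyRD.rate b dist P d)))
    {x : X} (hx : 0 < NoisyRD.marginal P x) {z : Z} (hz : z ∈ F) :
    Tendsto (fun a => (V a x : Measure Z).real {z}) l (𝓝 ((W x : Measure Z).real {z})) := by
  classical
  rw [tendsto_iff_ultrafilter]
  -- Along an ultrafilter the point masses converge, as they lie in the compact cube of functions
  -- with values in `[0, 1]`. It remains to show that the limit is an optimal kernel and to apply
  -- uniqueness.
  intro U hU
  set w : α → X → Z → ℝ := fun a x z => (V a x : Measure Z).real {z} with hw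
  have hw0 : ∀ a x, 0 ≤ w a x := fun a x z => measureReal_nonneg
  obtain ⟨w', hw', hlim⟩ := (isCompact_Icc (a := (0 : X → Z → ℝ)) (b := 1)).ultrafilter_le_nhds'
    (U.map w) (Ultrafilter.mem_map.2 (Filter.univ_mem' fun a =>
      ⟨fun x => hw0 a x, fun x z => measureReal_le_one⟩))
  have hlim' : ∀ x z, Tendsto (fun a => w a x z) U (𝓝 (w' x z)) := fun x z =>
    tendsto_pi_nhds.1 (tendsto_pi_nhds.1 (show Tendsto w U (𝓝 w') from hlim) x) z
  have hw'0 : ∀ x, 0 ≤ w' x := hw'.1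
  have hrep : ∀ᶠ a in U, ∀ x, 0 < NoisyRD.marginal P x →
      (V a x : Measure Z) = pointSum F (w a x) := by
    filter_upwards [hU hV, hU h.marginal_pos] with a ha hpos x hx
    exact kernel_eq_pointSum ha.2 ((hpos x).2 hx)
  -- All the measures live on the same finite set `F`, so no mass is lost in the limit.
  have hsum : ∀ x, 0 < NoisyRD.marginal P x → ∑ z ∈ F, w' x z = 1 := fun x hx =>
    tendsto_nhds_unique ((tendsto_finsetSum F fun z _ => hlim' x z).congr' (by
      filter_upwards [hrep] with a ha using sum_eq_one (hw0 a x) (ha x hx))) tendsto_const_nhds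
  have hprob : ∀ x, 0 < NoisyRD.marginal P x → IsProbabilityMeasure (pointSum F (w' x)) :=
    fun x hx => ⟨by rw [pointSum_univ F (hw'0 x), hsum x hx, ENNReal.ofReal_one]⟩
  let W' : RepKernel X Z := fun x =>
    if hx : 0 < NoisyRD.marginal P x then ⟨_, hprob x hx⟩ else W x
  have hW' : ∀ x, 0 < NoisyRD.marginal P x → (W' x : Measure Z) = pointSum F (w' x) :=
    fun x hx => by simp [W', hx]
  have hfin : ∀ᶠ a in U, ∀ y, 0 < P y → condDistortion dist (V a) y.1 y.2 ≠ ∞ := by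
    filter_upwards [hU hV, hU h.pos_iff, hU h.nonneg] with a ha hpos hQ y hy
    exact ((feasible_iff hdist hQ).1 ha.1.1).1 y ((hpos y).2 hy)
  have hfin' : ∀ y, 0 < P y → condDistortion dist W' y.1 y.2 ≠ ∞ := by
    intro y hy
    have hy2 := NoisyRD.marginal_pos hP hy
    rw [condDistortion_eq_sum (hW' _ hy2), ENNReal.sum_ne_top]
    intro z hz
    by_cases htop : dist y.1 z = ∞
    -- Finite mean distortion forces zero mass on points of infinite distortion, and this persists
    -- in the limit.
    · have h0 : w' y.2 z = 0 := tendsto_nhds_unique (hlim' y.2 z) (tendsto_const_nhds.congr' (by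
        filter_upwards [hrep, hfin] with a ha hf
        have h1 := hf y hy
        rw [condDistortion_eq_sum (ha _ hy2), ENNReal.sum_ne_top] at h1
        have h2 := h1 z hz
        by_contra hne
        have h3 : 0 < w a y.2 z := lt_of_le_of_ne (hw0 a y.2 z) hne
        exact h2 (by rw [htop, ENNReal.mul_top (by simpa using h3)])))
      rw [h0]; simp
    · exact ENNReal.mul_ne_top ENNReal.ofReal_ne_top htop
  have hfeas : Feasible dist P d W' := by
    refine (feasible_iff hdist hP).2 ⟨hfin', ?_⟩
    rw [expect_congr hP fun y hy => toReal_condDistortion_eq_sum (hw'0 y.2)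
      (hW' _ (NoisyRD.marginal_pos hP hy)) (hfin' y hy)]
    have t1 : Tendsto (fun a => expect (Q a) fun y => ∑ z ∈ F, w a y.2 z * (dist y.1 z).toReal) U
        (𝓝 (expect P fun y => ∑ z ∈ F, w' y.2 z * (dist y.1 z).toReal)) :=
      tendsto_finsetSum _ fun y _ => ((h.apply y).mono_left hU).mul
        (tendsto_finsetSum _ fun z _ => (hlim' y.2 z).mul_const _)
    refine le_of_tendsto_of_tendsto t1 ((h.mass.const_mul d).mono_left hU) ?_
    filter_upwards [hU hV, hU h.pos_iff, hU h.nonneg, hrep, hfin] with a ha hpos hQ hra hfa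
    refine le_of_eq_of_le ?_ ((feasible_iff hdist hQ).1 ha.1.1).2
    refine (expect_congr hQ fun y hy => ?_).symm
    have hy' := (hpos y).1 hy
    exact toReal_condDistortion_eq_sum (hw0 a y.2) (hra _ (NoisyRD.marginal_pos hP hy')) (hfa y hy')
  have hinfo : mutualInfo b P W' = NoisyRD.rate b dist P d := by
    refine tendsto_nhds_unique ?_ (hrate.mono_left hU)
    rw [mutualInfo_eq_sum hP hw'0 hW']
    have hp := marginal_nonneg hP
    have tm : ∀ z, Tendsto (fun a => mix (NoisyRD.marginal (Q a)) fun x => w a x z) U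
        (𝓝 (mix (NoisyRD.marginal P) fun x => w' x z)) := fun z =>
      tendsto_finsetSum _ fun x _ => ((h.marginal x).mono_left hU).mul (hlim' x z)
    have t1 : Tendsto (fun a => (∑ z ∈ F, (∑ x, NoisyRD.marginal (Q a) x *
        (w a x z * Real.log (w a x z)) - mix (NoisyRD.marginal (Q a)) (fun x => w a x z) *
          Real.log (mix (NoisyRD.marginal (Q a)) fun x => w a x z))) / Real.log b) U
        (𝓝 ((∑ z ∈ F, infoDensity (NoisyRD.marginal P) fun x => w' x z) / Real.log b)) := by
      refine (tendsto_finsetSum _ fun z _ => ?_).div_const _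
      rw [infoDensity_eq hp fun x => hw'0 x z]
      exact (tendsto_finsetSum _ fun x _ => ((h.marginal x).mono_left hU).mul
        ((Real.continuous_mul_log.tendsto _).comp (hlim' x z))).sub
        ((Real.continuous_mul_log.tendsto _).comp (tm z))
    refine t1.congr' ?_
    filter_upwards [hU hV, hU h.marginal_pos, hU h.nonneg, hrep] with a ha hpos hQ hra
    rw [← ha.1.2, mutualInfo_eq_sum hQ (hw0 a) fun x hx => hra x ((hpos x).1 hx)]
    congr 1
    exact Finset.sum_congr rfl fun z _ =>
      (infoDensity_eq (marginal_nonneg hQ) fun x => hw0 a x z).symm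
  have heq := IsOptimal.unique hb hdist hP hF hW ⟨hfeas, hinfo⟩ hx hz
  rw [hW' x hx, pointSum_real_singleton F (hw'0 x) hz] at heq
  rw [heq]
  exact hlim' x z

/-- The tilted information of optimal kernels converges. -/
lemma TendstoComparably.tiltedInfo (h : TendstoComparably l Q P c)
    (hdist : ∀ s, Measurable (dist s)) (hP : 0 ≤ P) {d : ℝ} {F : Finset Z}
    {W : RepKernel X Z} (hW : IsOptimal b dist P d W) (hWF : (output P W).support = F)
    {V : α → RepKernel X Z}
    (hV : ∀ᶠ a in l, IsOptimal b dist (Q a) d (V a) ∧ (output (Q a) (V a)).support = F)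
    (hlim : ∀ x, 0 < NoisyRD.marginal P x → ∀ z ∈ F,
      Tendsto (fun a => (V a x : Measure Z).real {z}) l (𝓝 ((W x : Measure Z).real {z})))
    {y : S × X} (hy : 0 < P y) :
    Tendsto (fun a => relEntropy b (V a y.2 : Measure Z) (output (Q a) (V a))) l
      (𝓝 (relEntropy b (W y.2 : Measure Z) (output P W))) ∧
    Tendsto (fun a => (condDistortion dist (V a) y.1 y.2).toReal) l
      (𝓝 (condDistortion dist W y.1 y.2).toReal) := by
  have hx := NoisyRD.marginal_pos hP hy
  have hp := marginal_nonneg hP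
  constructor
  · rw [relEntropy_eq_sum hP (fun x z => measureReal_nonneg)
      (fun x hx => kernel_eq_pointSum hWF hx) hx]
    have t1 : Tendsto (fun a => (∑ z ∈ F, (V a y.2 : Measure Z).real {z} *
        Real.log ((V a y.2 : Measure Z).real {z} / mix (NoisyRD.marginal (Q a))
          fun x => (V a x : Measure Z).real {z})) / Real.log b) l
        (𝓝 ((∑ z ∈ F, (W y.2 : Measure Z).real {z} *
        Real.log ((W y.2 : Measure Z).real {z} / mix (NoisyRD.marginal P)
          fun x => (W x : Measure Z).real {z})) / Real.log b)) := by
      refine (tendsto_finsetSum _ fun z hz => ?_).div_const _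
      have hmz := mix_pos_of_mem_support hP hWF hz
      have tm : Tendsto (fun a => mix (NoisyRD.marginal (Q a))
          fun x => (V a x : Measure Z).real {z}) l
          (𝓝 (mix (NoisyRD.marginal P) fun x => (W x : Measure Z).real {z})) := by
        refine tendsto_mix h.marginal (fun x hx => hlim x hx z hz) hp ?_
        filter_upwards [h.marginal_pos, h.nonneg] with a ha hQ x hx0
        by_contra hne
        exact ((ha x).1 (lt_of_le_of_ne (marginal_nonneg hQ x) (Ne.symm hne))).ne' hx0
      -- With output mass `m > 0`, the term `w * log (w / m)` equals `m` times `t * log t` at `t = w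
      -- / m`; this avoids a case distinction when `w` vanishes in the limit.
      have tr := (hlim y.2 hx z hz).div tm hmz.ne'
      have key := tm.mul ((Real.continuous_mul_log.tendsto _).comp tr)
      rw [← mul_assoc, mul_div_cancel₀ _ hmz.ne'] at key
      refine key.congr' ?_
      filter_upwards [tm.eventually (lt_mem_nhds hmz)] with a ha
      simp only [Function.comp_apply, Pi.div_apply]
      rw [← mul_assoc, mul_div_cancel₀ _ ha.ne']
    refine t1.congr' ?_
    filter_upwards [hV, h.marginal_pos, h.nonneg] with a ha hpos hQ
    rw [relEntropy_eq_sum hQ (fun x z => measureReal_nonneg)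
      (fun x hx => kernel_eq_pointSum ha.2 hx) ((hpos _).2 hx)]
  · rw [toReal_condDistortion_eq_sum (w := fun x z => (W x : Measure Z).real {z})
      (fun z => measureReal_nonneg) (kernel_eq_pointSum hWF hx)
      (((feasible_iff hdist hP).1 hW.1).1 y hy)]
    refine (tendsto_finsetSum _ fun z hz => (hlim y.2 hx z hz).mul_const _).congr' ?_
    filter_upwards [hV, h.marginal_pos, h.pos_iff, h.nonneg] with a ha hpos hpos' hQ
    exact (toReal_condDistortion_eq_sum (w := fun x z => (V a x : Measure Z).real {z})
      (fun z => measureReal_nonneg) (kernel_eq_pointSum ha.2 ((hpos _).2 hx))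
      (((feasible_iff hdist hQ).1 ha.1.1).1 y ((hpos' y).2 hy))).symm

end

/-! ### Perturbation of a single mass -/

lemma support_smul_measure [TopologicalSpace Z] (μ : Measure Z) {k : ℝ≥0∞} (hk : k ≠ 0) :
    (k • μ).support = μ.support := by
  ext z
  simp [Measure.mem_support_iff_forall, pos_iff_ne_zero, hk]

/-- Properties of the probability vectors near `P` carry over to unnormalized vectors. -/
lemma TendstoComparably.eventually_of_stdSimplex [TopologicalSpace Z] {α : Type*} {l : Filter α}
    {Q : α → S × X → ℝ} {P : S × X → ℝ} {c : α → ℝ} (h : TendstoComparably l Q P c) {b : ℝ}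
    (hb : 0 < Real.log b) {dist : S → Z → ℝ≥0∞} (hdist : ∀ s, Measurable (dist s))
    (hP : P ∈ stdSimplex ℝ (S × X)) {d : ℝ}
    (hmin : ∃ δ < d, ∃ V : RepKernel X Z, Feasible dist P δ V) {T : Set Z}
    (hnear : ∀ᶠ Q in 𝓝[stdSimplex ℝ (S × X)] P, (∃ W, IsOptimal b dist Q d W) ∧
      DifferentiableAt ℝ (fun δ => NoisyRD.rate b dist Q δ) d ∧
      ∀ W, IsOptimal b dist Q d W → (output Q W).support = T) :
    ∀ᶠ a in l, (∃ W, IsOptimal b dist (Q a) d W) ∧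
      DifferentiableAt ℝ (fun δ => NoisyRD.rate b dist (Q a) δ) d ∧
      ∀ W, IsOptimal b dist (Q a) d W → (output (Q a) W).support = T := by
  have hm : NoisyRD.mass P = 1 := hP.2
  have hmQ := h.mass
  rw [hm] at hmQ
  obtain ⟨δ₀, hδ₀, V, hV⟩ := hmin
  obtain ⟨δ₁, h01, h1d⟩ := exists_between hδ₀
  have hpos := hmQ.eventually (lt_mem_nhds one_pos)
  -- The assumption near `P` concerns probability vectors only. The normalized vectors converge to
  -- `P` within the simplex, and the scaling lemmas carry the properties back.
  have hlim : Tendsto (fun a => (NoisyRD.mass (Q a))⁻¹ • Q a) l (𝓝[stdSimplex ℝ (S × X)] P) := by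
    refine tendsto_nhdsWithin_iff.2 ⟨?_, ?_⟩
    · simpa using (hmQ.inv₀ one_ne_zero).smul h.tendsto
    · filter_upwards [hpos, h.nonneg] with a ha hQ
      refine ⟨fun y => mul_nonneg (inv_nonneg.2 ha.le) (hQ y), ?_⟩
      have := mass_smul (NoisyRD.mass (Q a))⁻¹ (Q a)
      rwa [inv_mul_cancel₀ ha.ne'] at this
  filter_upwards [hpos, h.nonneg, hlim.eventually hnear,
    h.eventually_feasible hdist hP.1 hm h01 hV] with a ha hQ hn hf
  obtain ⟨⟨W, hW⟩, hd, hs⟩ := hn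
  have hi := inv_pos.2 ha
  have hf' : Feasible dist ((NoisyRD.mass (Q a))⁻¹ • Q a) δ₁ V :=
    (feasible_smul_iff hdist hQ hi).2 hf
  have hQ' : 0 ≤ (NoisyRD.mass (Q a))⁻¹ • Q a := smul_nonneg hi.le hQ
  refine ⟨⟨W, (isOptimal_smul_iff hb hdist hQ hi).1 hW⟩, ?_, fun W hW => ?_⟩
  -- The scaling law of the rate requires feasibility, which is ensured for all levels above `δ₁ <
  -- d`, hence near `d`.
  · have he : (fun δ => NoisyRD.rate b dist (Q a) δ) =ᶠ[𝓝 d] fun δ =>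
        NoisyRD.mass (Q a) * NoisyRD.rate b dist ((NoisyRD.mass (Q a))⁻¹ • Q a) δ -
        NoisyRD.mass (Q a) * Real.log (NoisyRD.mass (Q a)) *
          NoisyRD.mass ((NoisyRD.mass (Q a))⁻¹ • Q a) / Real.log b := by
      filter_upwards [lt_mem_nhds h1d] with δ hδ
      rw [← rate_smul hb hdist hQ' ha ⟨V, hf'.mono hQ' hδ.le⟩, smul_smul, mul_inv_cancel₀ ha.ne',
        one_smul]
    exact ((hd.const_mul _).sub_const _).congr_of_eventuallyEq he
  · rw [← hs W ((isOptimal_smul_iff hb hdist hQ hi).2 hW), output_smul hi.le,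
      support_smul_measure _ (by simpa using ha)]

lemma sum_marginal_mul (P : S × X → ℝ) (D : X → ℝ) :
    ∑ x, marginal P x * D x = expect P fun y => D y.2 := by
  simp only [marginal, expect, Finset.sum_mul]
  rw [Fintype.sum_prod_type_right]

section

variable [DecidableEq S] [DecidableEq X]

lemma expect_update (P : S × X → ℝ) (y : S × X) (u : ℝ) (f : S × X → ℝ) :
    expect (Function.update P y u) f = expect P f + (u - P y) * f y := by
  have h : ∀ y', Function.update P y u y' * f y' =
      P y' * f y' + if y' = y then (u - P y) * f y else 0 := by
    intro y'
    rcases eq_or_ne y' y with rfl | hne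
    · simp; ring
    · simp [hne]
  simp [expect, h, Finset.sum_add_distrib]

lemma mass_update (P : S × X → ℝ) (y : S × X) (u : ℝ) :
    mass (Function.update P y u) = mass P + (u - P y) := by
  simpa [expect, mass] using expect_update P y u 1

lemma tendstoComparably_update {P : S × X → ℝ} (hP : 0 ≤ P) {y : S × X} (hy : 0 < P y) :
    TendstoComparably (𝓝 (P y)) (fun u => Function.update P y u) P
      fun u => max (u / P y) (P y / u) := by
  have hpos : ∀ᶠ u in 𝓝 (P y), 0 < u := lt_mem_nhds hy
  have hone : ∀ u, 0 < u → 1 ≤ max (u / P y) (P y / u) := by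
    intro u hu
    rcases le_total (P y) u with h | h
    · exact le_max_of_le_left ((one_le_div hy).2 h)
    · exact le_max_of_le_right ((one_le_div hu).2 h)
  refine ⟨?_, ?_, ?_, ?_, ?_⟩
  · have : Continuous fun u => Function.update P y u := continuous_const.update y continuous_id
    simpa using this.tendsto (P y)
  · have h1 : Tendsto (fun u => u / P y) (𝓝 (P y)) (𝓝 1) := by
      simpa [hy.ne'] using (tendsto_id (x := 𝓝 (P y))).div_const (P y)
    have h2 : Tendsto (fun u => P y / u) (𝓝 (P y)) (𝓝 1) := by
      have := (tendsto_const_nhds (x := P y)).div (tendsto_id (x := 𝓝 (P y))) hy.ne'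
      rwa [div_self hy.ne'] at this
    simpa using h1.max h2
  · filter_upwards [hpos] with u hu y'
    rcases eq_or_ne y' y with rfl | hne
    · simpa using hu.le
    · simpa [hne] using hP y'
  · filter_upwards [hpos] with u hu y'
    rcases eq_or_ne y' y with rfl | hne
    · rw [Function.update_self, ← div_le_iff₀ hu]
      exact le_max_right _ _
    · rw [Function.update_of_ne hne]
      exact le_mul_of_one_le_left (hP y') (hone u hu)
  · filter_upwards [hpos] with u hu y'
    rcases eq_or_ne y' y with rfl | hne
    · rw [Function.update_self, ← div_le_iff₀ hy]
      exact le_max_left _ _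
    · rw [Function.update_of_ne hne]
      exact le_mul_of_one_le_left (hP y') (hone u hu)

end

/-- Division by `u - u₀` reverses the inequalities on the left of `u₀`, so the difference quotient
is enclosed between the minimum and the maximum of `A` and `B` on both sides. -/
lemma hasDerivAt_of_le_of_le {r A B : ℝ → ℝ} {u₀ D : ℝ} (hA : Tendsto A (𝓝 u₀) (𝓝 D))
    (hB : Tendsto B (𝓝 u₀) (𝓝 D)) (hl : ∀ᶠ u in 𝓝 u₀, (u - u₀) * A u ≤ r u - r u₀)
    (hu : ∀ᶠ u in 𝓝 u₀, r u - r u₀ ≤ (u - u₀) * B u) : HasDerivAt r D u₀ := by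
  rw [hasDerivAt_iff_tendsto_slope]
  have hmin := (hA.min hB).mono_left (nhdsWithin_le_nhds (s := {u₀}ᶜ))
  have hmax := (hA.max hB).mono_left (nhdsWithin_le_nhds (s := {u₀}ᶜ))
  rw [min_self] at hmin
  rw [max_self] at hmax
  refine tendsto_of_tendsto_of_tendsto_of_le_of_le' hmin hmax ?_ ?_
  · filter_upwards [hl.filter_mono nhdsWithin_le_nhds, hu.filter_mono nhdsWithin_le_nhds,
      self_mem_nhdsWithin] with u h1 h2 h3
    rw [slope_def_field]
    rcases lt_or_gt_of_ne h3 with h | h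
    · refine min_le_iff.2 (Or.inr ?_)
      rw [le_div_iff_of_neg (sub_neg.2 h)]; linarith
    · refine min_le_iff.2 (Or.inl ?_)
      rw [le_div_iff₀ (sub_pos.2 h)]; linarith
  · filter_upwards [hl.filter_mono nhdsWithin_le_nhds, hu.filter_mono nhdsWithin_le_nhds,
      self_mem_nhdsWithin] with u h1 h2 h3
    rw [slope_def_field]
    rcases lt_or_gt_of_ne h3 with h | h
    · refine le_max_iff.2 (Or.inl ?_)
      rw [div_le_iff_of_neg (sub_neg.2 h)]; linarith
    · refine le_max_iff.2 (Or.inr ?_)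
      rw [div_le_iff₀ (sub_pos.2 h)]; linarith

/-- The mean of the tilted information is the rate. -/
lemma IsOptimal.expect_tiltedInfo {b : ℝ} {dist : S → Z → ℝ≥0∞} {Q : S × X → ℝ}
    (hb : 0 < Real.log b) (hdist : ∀ s, Measurable (dist s)) (hQ : 0 ≤ Q) (hm : 0 < mass Q) {d : ℝ}
    (hmin : ∃ δ < d, ∃ V : RepKernel X Z, Feasible dist Q δ V)
    (hd : DifferentiableAt ℝ (fun δ => rate b dist Q δ) d) {W : RepKernel X Z}
    (hW : IsOptimal b dist Q d W) : expect Q (tiltedInfo b dist Q d W) = rate b dist Q d := by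
  have h := hW.slackness hb hdist hQ hm hmin hd
  have e : expect Q (tiltedInfo b dist Q d W) =
      (expect Q fun y => relEntropy b (W y.2 : Measure Z) (output Q W)) + slope b dist Q d *
      (expect Q (fun y => (condDistortion dist W y.1 y.2).toReal) - d * mass Q) := by
    simp only [expect, mass, Finset.mul_sum, ← Finset.sum_sub_distrib, ← Finset.sum_add_distrib]
    exact Finset.sum_congr rfl fun y _ => by rw [tiltedInfo]; ring
  rw [e, h, add_zero, ← hW.2, mutualInfo, sum_marginal_mul Q fun x =>
    relEntropy b (W x : Measure Z) (output Q W)]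

lemma variance_congr_sub {P : S × X → ℝ} (hP : 0 ≤ P) (hm : mass P = 1) {f g : S × X → ℝ} {k : ℝ}
    (h : ∀ y, 0 < P y → f y = g y - k) : variance P f = variance P g := by
  have he : expect P f = expect P g - k := by
    have : expect P (fun y => g y - k) = expect P g - mass P * k := by
      simp [expect, mass, mul_sub, Finset.sum_sub_distrib, Finset.sum_mul]
    rw [expect_congr hP h, this, hm, one_mul]
  rw [variance, variance]
  refine expect_congr hP fun y hy => ?_
  rw [h y hy, he]
  ring

/-! ### The two partial derivatives -/

section

variable [TopologicalSpace Z] [T2Space Z] [SecondCountableTopology Z] [BorelSpace Z]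
  [DecidableEq S] [DecidableEq X]

/-- The partial derivatives of the noisy rate-distortion function and of the mean tilted
information. -/
lemma hasDerivAt_rate_and_tiltedInfo {b : ℝ} (hb : 0 < Real.log b) {dist : S → Z → ℝ≥0∞}
    (hdist : ∀ s, Measurable (dist s)) {P : S × X → ℝ} (hP : P ∈ stdSimplex ℝ (S × X)) {d : ℝ}
    (hmin : ∃ δ < d, ∃ V : RepKernel X Z, Feasible dist P δ V)
    {Wstar : (S × X → ℝ) → RepKernel X Z}
    (hWstar : ∀ Q : S × X → ℝ, (∃ W, IsOptimal b dist Q d W) → IsOptimal b dist Q d (Wstar Q))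
    (hopt : IsOptimal b dist P d (Wstar P)) (heq : (expDistortion dist P (Wstar P)).toReal = d)
    (hnear : ∀ᶠ Q in 𝓝[stdSimplex ℝ (S × X)] P, (∃ W, IsOptimal b dist Q d W) ∧
      DifferentiableAt ℝ (fun δ => rate b dist Q δ) d ∧
      ∀ W, IsOptimal b dist Q d W → (output Q W).support = (output P (Wstar P)).support)
    {y : S × X} (hy : 0 < P y) :
    HasDerivAt (fun u => rate b dist (Function.update P y u) d)
      (tiltedInfo b dist P d (Wstar P) y - 1 / Real.log b) (P y) ∧
    HasDerivAt (fun u => expect P (tiltedInfo b dist (Function.update P y u) d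
      (Wstar (Function.update P y u)))) (-(1 / Real.log b)) (P y) := by
  have hP0 : 0 ≤ P := hP.1
  have hm : mass P = 1 := hP.2
  obtain ⟨-, hdP, hsP⟩ := hnear.self_of_nhdsWithin hP
  have hfin := hopt.finite_support hb hdist hP0 hsP
  obtain ⟨F, hF⟩ := hfin.exists_finset_coe
  have hsF : ∀ V, IsOptimal b dist P d V → (output P V).support = F := fun V hV => by
    rw [hF]; exact hsP V hV
  have h := tendstoComparably_update hP0 hy
  have hev := h.eventually_of_stdSimplex hb hdist hP hmin hnear
  have hV : ∀ᶠ u in 𝓝 (P y), IsOptimal b dist (Function.update P y u) d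
      (Wstar (Function.update P y u)) ∧
      (output (Function.update P y u) (Wstar (Function.update P y u))).support = F := by
    filter_upwards [hev] with u hu
    have := hWstar _ hu.1
    exact ⟨this, by rw [hF]; exact hu.2.2 _ this⟩
  have hdQ : ∀ᶠ u in 𝓝 (P y),
      DifferentiableAt ℝ (fun δ => rate b dist (Function.update P y u) δ) d :=
    hev.mono fun u hu => hu.2.1
  have hslope := h.slope hb hdist hP0 hm hmin hdP hdQ
  have hminQ : ∀ᶠ u in 𝓝 (P y), ∃ δ < d, ∃ V : RepKernel X Z,
      Feasible dist (Function.update P y u) δ V := by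
    obtain ⟨δ₀, hδ₀, V, hV⟩ := hmin
    obtain ⟨δ₁, h01, h1d⟩ := exists_between hδ₀
    filter_upwards [h.eventually_feasible hdist hP0 hm h01 hV] with u hu using ⟨δ₁, h1d, V, hu⟩
  have hrate : Tendsto (fun u => rate b dist (Function.update P y u) d) (𝓝 (P y))
      (𝓝 (rate b dist P d)) := by
    obtain ⟨δ₀, hδ₀, V, hV⟩ := hmin
    exact h.rate hb hdist hP0 hm hδ₀ hV
  obtain ⟨hD, hg⟩ := h.tiltedInfo (b := b) hdist hP0 hopt hF.symm hV
    (fun x hx z hz => h.kernel hb hdist hP0 hsF hopt hV hrate hx hz) hy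
  have hmass : Tendsto (fun u => mass (Function.update P y u)) (𝓝 (P y)) (𝓝 1) := by
    have := h.mass
    rwa [hm] at this
  have hmassE : ∀ u, mass (Function.update P y u) = 1 + (u - P y) := fun u => by
    rw [mass_update, hm]
  have hoptf := (feasible_iff hdist hP0).1 hopt.1
  rw [toReal_expDistortion hdist hP0 hopt.1.1] at heq
  set L := Real.log b with hL
  set lam := slope b dist P d with hlam
  set D₀ := relEntropy b (Wstar P y.2 : Measure Z) (output P (Wstar P)) with hD₀
  set g₀ := (condDistortion dist (Wstar P) y.1 y.2).toReal with hg₀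
  set D : ℝ → ℝ := fun u => relEntropy b (Wstar (Function.update P y u) y.2 : Measure Z)
    (output (Function.update P y u) (Wstar (Function.update P y u)))
  set g : ℝ → ℝ := fun u => (condDistortion dist (Wstar (Function.update P y u)) y.1 y.2).toReal
  have htilt : tiltedInfo b dist P d (Wstar P) y = D₀ + lam * g₀ - lam * d := rfl
  have hder : HasDerivAt (fun u => rate b dist (Function.update P y u) d)
      (tiltedInfo b dist P d (Wstar P) y - 1 / L) (P y) := by
    -- `A` combines the perturbed optimal kernel with the slope at `P`; `B` combines the optimal
    -- kernel at `P` with the perturbed slope.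
    refine hasDerivAt_of_le_of_le (A := fun u => D u + lam * (g u - d) - 1 / L)
      (B := fun u => D₀ + slope b dist (Function.update P y u) d /
        mass (Function.update P y u) * (g₀ - d) - 1 / L) ?_ ?_ ?_ ?_
    · have := (hD.add ((hg.sub_const d).const_mul lam)).sub_const (1 / L)
      rwa [htilt, add_sub_assoc, ← mul_sub]
    · have := ((((hslope.div hmass one_ne_zero).mul_const (g₀ - d)).const_add D₀)).sub_const (1 / L)
      rw [div_one] at this
      rwa [htilt, add_sub_assoc, ← mul_sub]
    -- Lower bound: the kernel optimal for the perturbed vector serves as a test kernel at `P`.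
    · filter_upwards [hV, h.nonneg, h.pos_iff, h.marginal_pos] with u hVu hQ hpos hmpos
      have hVf := (feasible_iff hdist hQ).1 hVu.1.1
      have h1 := rate_le_lagrangian hb hdist hP0 (by rw [hm]; exact one_pos) hmin hdP
        (W := Wstar (Function.update P y u)) fun y' hy' => hVf.1 y' ((hpos y').2 hy')
      have h2 := mutualInfo_le_sum_relEntropy hb hP0 hQ (fun x hx => (hmpos x).2 hx)
        (Wstar (Function.update P y u))
      have h3 := hVu.1.2
      rw [mutualInfo, sum_marginal_mul _ fun x => relEntropy b
        (Wstar (Function.update P y u) x : Measure Z)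
        (output (Function.update P y u) (Wstar (Function.update P y u))), expect_update] at h3
      rw [sum_marginal_mul P fun x => relEntropy b
        (Wstar (Function.update P y u) x : Measure Z)
        (output (Function.update P y u) (Wstar (Function.update P y u))), hmassE, hm] at h2
      have h4 := hVf.2
      rw [expect_update, hmassE] at h4
      rw [hm, div_one] at h1
      have h5 := mul_le_mul_of_nonneg_left h4 (slope_nonneg_and_tangent hb hdist hP0 hmin hdP).1
      rw [Function.update_eq_self]
      have h6 : (1 + (u - P y) - 1) / L = (u - P y) * (1 / L) := by ring
      rw [h6] at h2
      simp only [D, g]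
      linarith
    -- Upper bound: the kernel optimal at `P` is tested on the perturbed vector. Equality in the
    -- distortion constraint makes its excess distortion there exactly proportional to `u - P y`.
    · filter_upwards [hV, h.nonneg, h.pos_iff, h.marginal_pos, hdQ, hminQ,
        hmass.eventually (lt_mem_nhds one_pos)] with u hVu hQ hpos hmpos hdu hmu hmass0
      have h1 := rate_le_lagrangian hb hdist hQ hmass0 hmu hdu
        (W := Wstar P) fun y' hy' => hoptf.1 y' ((hpos y').1 hy')
      have h2 := mutualInfo_le_sum_relEntropy hb hQ hP0 (fun x hx => (hmpos x).1 hx) (Wstar P)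
      have h3 := hopt.2
      rw [mutualInfo, sum_marginal_mul _ fun x => relEntropy b
        (Wstar P x : Measure Z) (output P (Wstar P))] at h3
      rw [sum_marginal_mul _ fun x => relEntropy b
        (Wstar P x : Measure Z) (output P (Wstar P)), expect_update, hmassE, hm] at h2
      rw [expect_update, heq] at h1
      rw [Function.update_eq_self]
      have h6 : (1 - (1 + (u - P y))) / L = -((u - P y) * (1 / L)) := by ring
      have h7 : slope b dist (Function.update P y u) d *
          ((d + (u - P y) * g₀) / mass (Function.update P y u) - d) =
          (u - P y) * (slope b dist (Function.update P y u) d /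
            mass (Function.update P y u) * (g₀ - d)) := by
        have h8 : (d + (u - P y) * g₀) / mass (Function.update P y u) - d =
            (u - P y) * (g₀ - d) / mass (Function.update P y u) := by
          rw [div_sub' hmass0.ne', hmassE]
          ring
        rw [h8]
        ring
      rw [h6] at h2
      rw [h7] at h1
      linarith
  refine ⟨hder, ?_⟩
  set t : ℝ → ℝ := fun u => tiltedInfo b dist (Function.update P y u) d
    (Wstar (Function.update P y u)) y with ht
  have ht0 : t (P y) = tiltedInfo b dist P d (Wstar P) y := by
    simp only [ht, Function.update_eq_self]
  have htlim : Tendsto t (𝓝 (P y)) (𝓝 (tiltedInfo b dist P d (Wstar P) y)) :=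
    (hD.add (hslope.mul hg)).sub (hslope.mul_const d)
  -- The factor `u - P y` vanishes at the base point, so convergence of `t` to its value there
  -- suffices; no derivative of the tilted information is needed.
  have hsub : HasDerivAt (fun u => (u - P y) * t u) (tiltedInfo b dist P d (Wstar P) y) (P y) := by
    refine hasDerivAt_of_le_of_le htlim htlim ?_ ?_ <;> exact .of_forall fun u => by simp
  have hfinal := hder.sub hsub
  rw [sub_sub_cancel_left] at hfinal
  refine hfinal.congr_of_eventuallyEq ?_
  filter_upwards [hV, h.nonneg, hdQ, hminQ, hmass.eventually (lt_mem_nhds one_pos)]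
    with u hVu hQ hdu hmu hmass0
  have h1 := hVu.1.expect_tiltedInfo hb hdist hQ hmass0 hmu hdu
  rw [expect_update] at h1
  simp only [Pi.sub_apply, ht]
  linarith

end

end NoisyRD

end

theorem theorem1 {S X Z : Type*} [Fintype S] [DecidableEq S] [Fintype X] [DecidableEq X]
    [TopologicalSpace Z] [T2Space Z] [SecondCountableTopology Z]
    [MeasurableSpace Z] [BorelSpace Z]
    -- base of the logarithm, distortion measure, joint law of `(S, X)`, distortion level
    (b : ℝ) (hb : 1 < b)
    (dist : S → Z → ℝ≥0∞) (hdist : ∀ s, Measurable (dist s))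
    (P : S × X → ℝ) (hP : P ∈ stdSimplex ℝ (S × X)) (d : ℝ)
    -- `d > d_min`
    (hmin : ∃ δ < d, ∃ V : NoisyRD.RepKernel X Z, NoisyRD.Feasible dist P δ V)
    -- a choice of an optimal kernel for every joint law that has one
    (Wstar : (S × X → ℝ) → NoisyRD.RepKernel X Z)
    (hWstar : ∀ Q : S × X → ℝ, (∃ W, NoisyRD.IsOptimal b dist Q d W) →
      NoisyRD.IsOptimal b dist Q d (Wstar Q))
    -- the infimum at `P` is achieved, with equality in the distortion constraint
    (hopt : NoisyRD.IsOptimal b dist P d (Wstar P))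
    (heq : (NoisyRD.expDistortion dist P (Wstar P)).toReal = d)
    -- for all joint laws `Q` near `P`: the infimum is achieved, the rate-distortion function is
    -- differentiable at `d`, and every optimal reproduction distribution has the same support
    (hnear : ∀ᶠ Q in 𝓝[stdSimplex ℝ (S × X)] P,
      (∃ W, NoisyRD.IsOptimal b dist Q d W) ∧
      DifferentiableAt ℝ (fun δ => NoisyRD.rate b dist Q δ) d ∧
      ∀ W, NoisyRD.IsOptimal b dist Q d W →
        (NoisyRD.output Q W).support = (NoisyRD.output P (Wstar P)).support) :
    (∀ y : S × X, 0 < P y →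
      HasDerivAt
        (fun u => NoisyRD.expect P
          (NoisyRD.tiltedInfo b dist (Function.update P y u) d
            (Wstar (Function.update P y u))))
        (-Real.logb b (Real.exp 1)) (P y)) ∧
    (∀ y : S × X, 0 < P y →
      HasDerivAt (fun u => NoisyRD.rate b dist (Function.update P y u) d)
        (NoisyRD.tiltedInfo b dist P d (Wstar P) y - Real.logb b (Real.exp 1)) (P y)) ∧
    NoisyRD.variance P (NoisyRD.partialRate b dist P d)
      = NoisyRD.variance P (NoisyRD.tiltedInfo b dist P d (Wstar P)) := by
  have hL : 0 < Real.log b := Real.log_pos hb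
  have hlog : Real.logb b (Real.exp 1) = 1 / Real.log b := by rw [Real.logb, Real.log_exp]
  rw [hlog]
  have key := fun (y : S × X) (hy : 0 < P y) =>
    NoisyRD.hasDerivAt_rate_and_tiltedInfo hL hdist hP hmin hWstar hopt heq hnear hy
  exact ⟨fun y hy => (key y hy).2, fun y hy => (key y hy).1,
    NoisyRD.variance_congr_sub hP.1 hP.2 fun y hy => (key y hy).1.deriv⟩
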